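/- Let $g \ge 0$ and $p \ge 2$ be integers, and let $F_{g,p}$ be the free group with basis $t_1,\dots,t_p,x_1,\dots,x_g,y_1,\dots,y_g$. For elements $u,v$ of a group write $[u,v] := u^{-1}v^{-1}uv$ and $u^v := v^{-1}uv$. Let $A_{g,p}$ denote the group of all automorphisms of $F_{g,p}$ that fix the element $t_p t_{p-1}\cdots t_1\,[x_1,y_1][x_2,y_2]\cdots[x_g,y_g]$ and that permute the set of the conjugacy classes of $t_1,\dots,t_p$ in $F_{g,p}$. Let $\operatorname{Stab}(t_p;A_{g,p})$ be the subgroup of the elements of $A_{g,p}$ that fix $t_p$, and let $\sigma_p$ be the automorphism of $F_{g,p}$ with $t_p \mapsto t_{p-1}$ and $t_{p-1}\mapsto t_p^{\,t_{p-1}}$ that fixes every other basis element. Then $\sigma_p \in A_{g,p}$, and $A_{g,p}$ is generated by $\operatorname{Stab}(t_p;A_{g,p})\cup\{\sigma_p\}$. -/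

import Mathlib

namespace SurfaceAut

/-- The distinguished basis `t_1, …, t_p, x_1, …, x_g, y_1, …, y_g`.
Indices start at `0` here: `t i` is `t_{i+1}`, and similarly for `x` and `y`. -/
inductive Letter (g p : ℕ) : Type
  | t (j : Fin p) : Letter g p
  | x (i : Fin g) : Letter g p
  | y (i : Fin g) : Letter g p

/-- The free group `F_{g,p}` of rank `2g + p`. -/
abbrev F (g p : ℕ) : Type := FreeGroup (Letter g p)

variable {g p : ℕ}

/-- The generator `t_{j+1}`. -/
def t (g : ℕ) {p : ℕ} (j : Fin p) : F g p := FreeGroup.of (Letter.t j)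

/-- The generator `x_{i+1}`. -/
def x {g : ℕ} (p : ℕ) (i : Fin g) : F g p := FreeGroup.of (Letter.x i)

/-- The generator `y_{i+1}`. -/
def y {g : ℕ} (p : ℕ) (i : Fin g) : F g p := FreeGroup.of (Letter.y i)

/-- The commutator with the convention `[u, v] = u⁻¹ v⁻¹ u v`. -/
def comm {G : Type*} [Group G] (u v : G) : G := u⁻¹ * v⁻¹ * u * v

/-- The element `t_p t_{p-1} ⋯ t_1 [x_1, y_1] [x_2, y_2] ⋯ [x_g, y_g]`. -/
def boundaryWord (g p : ℕ) : F g p :=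
  (List.ofFn fun j : Fin p => t g j).reverse.prod *
    (List.ofFn fun i : Fin g => comm (x p i) (y p i)).prod

/-- The set of conjugacy classes `{[t_1], …, [t_p]}`. -/
def tClasses (g p : ℕ) : Set (ConjClasses (F g p)) :=
  Set.range fun j : Fin p => ConjClasses.mk (t g j)

/-- The group `A_{g,p}` of all automorphisms of `F_{g,p}` that fix
`t_p ⋯ t_1 [x_1, y_1] ⋯ [x_g, y_g]` and permute the set `{[t_1], …, [t_p]}`. -/
def A (g p : ℕ) : Subgroup (MulAut (F g p)) where
  carrier := {φ | φ (boundaryWord g p) = boundaryWord g p ∧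
    ConjClasses.map φ.toMonoidHom '' tClasses g p = tClasses g p}
  one_mem' := by
    refine ⟨rfl, ?_⟩
    have h : ConjClasses.map (1 : MulAut (F g p)).toMonoidHom = id := by
      funext c
      induction c using Quotient.inductionOn
      rfl
    rw [h, Set.image_id]
  mul_mem' := by
    rintro φ ψ ⟨h₁, h₂⟩ ⟨h₃, h₄⟩
    refine ⟨by rw [MulAut.mul_apply, h₃, h₁], ?_⟩
    have h : ConjClasses.map (φ * ψ).toMonoidHom =
        ConjClasses.map φ.toMonoidHom ∘ ConjClasses.map ψ.toMonoidHom := by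
      funext c
      induction c using Quotient.inductionOn
      rfl
    rw [h, Set.image_comp, h₄, h₂]
  inv_mem' := by
    rintro φ ⟨h₁, h₂⟩
    refine ⟨?_, ?_⟩
    · conv_lhs => rw [← h₁]
      exact MulAut.inv_apply_self _ φ _
    · have h : ConjClasses.map (φ⁻¹).toMonoidHom ∘ ConjClasses.map φ.toMonoidHom = id := by
        funext c
        induction c using Quotient.inductionOn with
        | h a => exact congrArg ConjClasses.mk (MulAut.inv_apply_self _ φ a)
      conv_lhs => rw [← h₂]
      rw [← Set.image_comp, h, Set.image_id]

/-- The stabilizer `Stab(u; A_{g,p})` of an element `u` of `F_{g,p}`. -/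
def stabA (u : F g p) : Subgroup (MulAut (F g p)) :=
  A g p ⊓ MulAction.stabilizer (MulAut (F g p)) u

/-- The endomorphism with `t_k ↦ t_l`, `t_l ↦ t_l⁻¹ t_k t_l`, fixing all other basis elements. -/
def twistHom (g : ℕ) {p : ℕ} (k l : Fin p) : F g p →* F g p :=
  FreeGroup.lift fun
    | .t j => if j = k then t g l else if j = l then (t g l)⁻¹ * t g k * t g l else t g j
    | .x i => x p i
    | .y i => y p i

/-- The endomorphism with `t_l ↦ t_k`, `t_k ↦ t_k t_l t_k⁻¹`, fixing all other basis elements. -/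
def twistInvHom (g : ℕ) {p : ℕ} (k l : Fin p) : F g p →* F g p :=
  FreeGroup.lift fun
    | .t j => if j = l then t g k else if j = k then t g k * t g l * (t g k)⁻¹ else t g j
    | .x i => x p i
    | .y i => y p i

/-- For `k ≠ l`, the automorphism with `t_k ↦ t_l`, `t_l ↦ t_l⁻¹ t_k t_l`, fixing all other
basis elements. -/
def twist (g : ℕ) {p : ℕ} (k l : Fin p) (hkl : k ≠ l) : MulAut (F g p) :=
  MonoidHom.toMulEquiv (twistHom g k l) (twistInvHom g k l)
    (by
      ext a
      rcases a with j | i | i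
      · by_cases h₁ : j = k
        · subst h₁
          simp [twistHom, twistInvHom, t]
        · by_cases h₂ : j = l
          · subst h₂
            simp [twistHom, twistInvHom, t, h₁, hkl, mul_assoc]
          · simp [twistHom, twistInvHom, t, h₁, h₂]
      · simp [twistHom, twistInvHom, x]
      · simp [twistHom, twistInvHom, y])
    (by
      ext a
      rcases a with j | i | i
      · by_cases h₁ : j = l
        · subst h₁
          simp [twistHom, twistInvHom, t]
        · by_cases h₂ : j = k
          · subst h₂
            simp [twistHom, twistInvHom, t, h₁, hkl.symm, mul_assoc]
          · simp [twistHom, twistInvHom, t, h₁, h₂]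
      · simp [twistHom, twistInvHom, x]
      · simp [twistHom, twistInvHom, y])

/-- For `2 ≤ j ≤ p`, the braid twist
`σ_j = (t_j ↦ t_{j-1}, t_{j-1} ↦ t_{j-1}⁻¹ t_j t_{j-1})`, with `j` counted from `1`. -/
def sigma (g p j : ℕ) (h2 : 2 ≤ j) (hj : j ≤ p) : MulAut (F g p) :=
  twist g (⟨j - 1, by omega⟩ : Fin p) ⟨j - 2, by omega⟩
    (by rw [Ne, Fin.mk.injEq]; omega)

end SurfaceAut

namespace FreeGroup

section Code
variable {α : Type*} [Fintype α]

/-- The base used to encode words as natural numbers. -/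
def codeBase (α : Type*) [Fintype α] : ℕ := Fintype.card (α × Bool) + 3

/-- An encoding of words as natural numbers, monotone for the lexicographic order on words of
equal length. -/
noncomputable def code (L : List (α × Bool)) : ℕ :=
  Nat.ofDigits (codeBase α) (L.map fun a => (Fintype.equivFin (α × Bool) a : ℕ)).reverse

theorem one_lt_codeBase : 1 < codeBase α := by unfold codeBase; omega

theorem code_append (L M : List (α × Bool)) :
    code (L ++ M) = code M + codeBase α ^ M.length * code L := by
  simp [code, Nat.ofDigits_append]

theorem digit_lt_codeBase (a : α × Bool) : (Fintype.equivFin (α × Bool) a : ℕ) < codeBase α := by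
  have := (Fintype.equivFin (α × Bool) a).isLt
  unfold codeBase; omega

theorem code_lt (L : List (α × Bool)) : code L < codeBase α ^ L.length := by
  have := Nat.ofDigits_lt_base_pow_length (b := codeBase α)
    (l := (L.map fun a => (Fintype.equivFin (α × Bool) a : ℕ)).reverse) one_lt_codeBase
    (by intro x hx; simp only [List.mem_reverse, List.mem_map] at hx
        obtain ⟨a, -, rfl⟩ := hx; exact digit_lt_codeBase a)
  simpa [code] using this

theorem eq_of_code_eq {L M : List (α × Bool)} (hl : L.length = M.length) (h : code L = code M) :
    L = M := by
  have key : ∀ (K : List (α × Bool)),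
      ∀ l ∈ (K.map fun a => (Fintype.equivFin (α × Bool) a : ℕ)).reverse, l < codeBase α := by
    intro K x hx
    simp only [List.mem_reverse, List.mem_map] at hx
    obtain ⟨a, -, rfl⟩ := hx; exact digit_lt_codeBase a
  have := Nat.ofDigits_inj_of_len_eq one_lt_codeBase (by simpa using hl) (key L) (key M) h
  have := List.reverse_injective this
  refine List.map_injective_iff.2 ?_ this
  intro a b hab
  exact (Fintype.equivFin (α × Bool)).injective (Fin.ext hab)

theorem code_append_lt {L M : List (α × Bool)} (h : code L < code M) (K : List (α × Bool)) :
    code (L ++ K) < code (M ++ K) := by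
  rw [code_append, code_append]
  have : 0 < codeBase α ^ K.length := Nat.pow_pos (by have := one_lt_codeBase (α := α); omega)
  have := Nat.mul_lt_mul_of_pos_left h this
  omega

end Code

variable {α : Type*} [DecidableEq α]

/-- The longest common prefix of two lists. -/
def commonPrefix {β : Type*} [DecidableEq β] : List β → List β → List β
  | a :: l, b :: m => if a = b then a :: commonPrefix l m else []
  | _, _ => []

theorem commonPrefix_spec {β : Type*} [DecidableEq β] (l m : List β) :
    ∃ p q, l = commonPrefix l m ++ p ∧ m = commonPrefix l m ++ q ∧
      ∀ a ∈ p.head?, ∀ b ∈ q.head?, a ≠ b := by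
  induction l generalizing m with
  | nil => exact ⟨[], m, by simp [commonPrefix], by simp [commonPrefix], by simp⟩
  | cons a l ih =>
    cases m with
    | nil => exact ⟨a :: l, [], by simp [commonPrefix], by simp [commonPrefix], by simp⟩
    | cons b m =>
      by_cases h : a = b
      · subst h
        obtain ⟨p, q, h₁, h₂, h₃⟩ := ih m
        exact ⟨p, q, by simpa [commonPrefix] using h₁, by simpa [commonPrefix] using h₂, h₃⟩
      · exact ⟨a :: l, b :: m, by simp [commonPrefix, h], by simp [commonPrefix, h], by simpa using h⟩

theorem commonPrefix_comm {β : Type*} [DecidableEq β] (l m : List β) :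
    commonPrefix l m = commonPrefix m l := by
  induction l generalizing m with
  | nil => cases m <;> simp [commonPrefix]
  | cons a l ih =>
    cases m with
    | nil => simp [commonPrefix]
    | cons b m =>
      by_cases h : a = b
      · subst h; simp [commonPrefix, ih m]
      · simp [commonPrefix, h, Ne.symm h]

/-- The word cancelled in the product `c * d`, as a prefix of the reduced word of `d`. -/
def cancelled (c d : FreeGroup α) : List (α × Bool) := commonPrefix (toWord c⁻¹) (toWord d)

theorem cancelled_inv (c d : FreeGroup α) : cancelled d⁻¹ c⁻¹ = cancelled c d := by
  rw [cancelled, inv_inv, commonPrefix_comm, cancelled]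

theorem toWord_mk_of_length_le {L : List (α × Bool)} (h : L.length ≤ norm (mk L)) :
    toWord (mk L) = L := by
  rw [norm, toWord_mk] at h
  rw [toWord_mk]
  exact (Red.sublist reduce.red).eq_of_length_le h

theorem invRev_toWord_inv (c : FreeGroup α) : toWord c = invRev (toWord c⁻¹) := by
  rw [toWord_inv, invRev_invRev]

/-- The first half of the reduced word of an element, without the middle letter. -/
def initHalf (z : FreeGroup α) : List (α × Bool) := (toWord z).take (norm z / 2)

theorem length_initHalf (z : FreeGroup α) : (initHalf z).length = norm z / 2 := by
  rw [initHalf, List.length_take, norm]; omega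

section Weight
variable [Fintype α]

/-- A measure of elements refining the word length; ties are broken by the codes of the two
halves. -/
noncomputable def weight (z : FreeGroup α) : ℕ :=
  codeBase α ^ norm z + (code (initHalf z) + code (initHalf z⁻¹))

theorem weight_inv (z : FreeGroup α) : weight z⁻¹ = weight z := by
  rw [weight, weight, norm_inv_eq, inv_inv, add_comm (code _)]

theorem weight_lt_of_norm_lt {z z' : FreeGroup α} (h : norm z < norm z') : weight z < weight z' := by
  have hb := one_lt_codeBase (α := α)
  have h3 : 3 ≤ codeBase α := by unfold codeBase; omega
  have h1 := code_lt (initHalf z)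
  have h2 := code_lt (initHalf z⁻¹)
  rw [length_initHalf] at h1 h2
  rw [norm_inv_eq] at h2
  have h4 : codeBase α ^ (norm z / 2) ≤ codeBase α ^ norm z :=
    Nat.pow_le_pow_right (by omega) (by omega)
  have h5 : codeBase α ^ (norm z + 1) ≤ codeBase α ^ norm z' :=
    Nat.pow_le_pow_right (by omega) h
  have h6 : 3 * codeBase α ^ norm z ≤ codeBase α ^ (norm z + 1) := by
    rw [pow_succ, mul_comm]; exact Nat.mul_le_mul_left _ h3
  rw [weight, weight]; omega

/-- Multiplication on the left by an element of which at least half is cancelled. -/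
theorem weight_mul_lt {c d : FreeGroup α} {C p q : List (α × Bool)}
    (hc : toWord c⁻¹ = C ++ p) (hd : toWord d = C ++ q)
    (h : p.length < C.length ∨
      p.length = C.length ∧ code (invRev p) < code C ∧ C.length ≤ q.length) :
    weight (c * d) < weight d := by
  have hc' : toWord c = invRev p ++ invRev C := by
    rw [invRev_toWord_inv, hc, invRev_append]
  have hcd : c * d = mk (invRev p ++ q) := by
    rw [← mk_toWord (x := c), ← mk_toWord (x := d), hc', hd, ← mul_mk, ← mul_mk, ← mul_mk,
      ← inv_mk (L := C)]
    group
  have hn : norm (c * d) ≤ p.length + q.length := by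
    rw [hcd]; refine norm_mk_le.trans ?_; simp
  have hnd : norm d = C.length + q.length := by rw [norm, hd]; simp
  rcases h with h | ⟨h1, h2, h3⟩
  · exact weight_lt_of_norm_lt (by omega)
  · rcases hn.lt_or_eq with hlt | heq
    · exact weight_lt_of_norm_lt (by omega)
    · have hw : toWord (c * d) = invRev p ++ q := by
        rw [hcd]; apply toWord_mk_of_length_le; rw [← hcd, heq]; simp
      have e1 : initHalf (c * d) = invRev p ++ q.take ((C.length + q.length) / 2 - C.length) := by
        rw [initHalf, hw, heq, List.take_append, List.take_of_length_le (by simp; omega)]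
        simp [h1]
      have e2 : initHalf d = C ++ q.take ((C.length + q.length) / 2 - C.length) := by
        rw [initHalf, hd, hnd, List.take_append, List.take_of_length_le (by omega)]
      have e3 : initHalf (c * d)⁻¹ = initHalf d⁻¹ := by
        rw [initHalf, initHalf, toWord_inv, toWord_inv, hw, hd, invRev_append, invRev_append,
          norm_inv_eq, norm_inv_eq, heq, hnd, List.take_append_of_le_length (by simp; omega),
          List.take_append_of_le_length (by simp; omega), h1]
      rw [weight, weight, e1, e2, e3, heq, hnd, h1]
      have := code_append_lt h2 (q.take ((C.length + q.length) / 2 - C.length))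
      omega

/-- Conjugation by an element of which at least half is cancelled in the first half of a
conjugate of a letter. -/
theorem weight_conj_lt {c d : FreeGroup α} {C p r : List (α × Bool)}
    (hc : toWord c⁻¹ = C ++ p) (hd : toWord d = C ++ r ++ invRev C)
    (h : p.length < C.length ∨ p.length = C.length ∧ code (invRev p) < code C) :
    weight (c * d * c⁻¹) < weight d := by
  have hc' : toWord c = invRev p ++ invRev C := by
    rw [invRev_toWord_inv, hc, invRev_append]
  have hcd : c * d * c⁻¹ = mk (invRev p ++ r ++ p) := by
    rw [← mk_toWord (x := c), ← mk_toWord (x := d), hc', hd, ← mul_mk, ← mul_mk, ← mul_mk,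
      ← mul_mk, ← mul_mk, ← inv_mk (L := C), ← inv_mk (L := p)]
    group
  have hn : norm (c * d * c⁻¹) ≤ p.length + r.length + p.length := by
    rw [hcd]; refine norm_mk_le.trans ?_; simp; omega
  have hnd : norm d = C.length + r.length + C.length := by rw [norm, hd]; simp; omega
  rcases h with h | ⟨h1, h2⟩
  · exact weight_lt_of_norm_lt (by omega)
  · rcases hn.lt_or_eq with hlt | heq
    · exact weight_lt_of_norm_lt (by omega)
    · have hw : toWord (c * d * c⁻¹) = invRev p ++ (r ++ p) := by
        rw [hcd, List.append_assoc]; apply toWord_mk_of_length_le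
        rw [← List.append_assoc, ← hcd, heq]; simp; omega
      have hwi : toWord (c * d * c⁻¹)⁻¹ = invRev p ++ (invRev r ++ p) := by
        rw [toWord_inv, hw]; simp [invRev_append, invRev_invRev]
      have hdi : toWord d⁻¹ = C ++ (invRev r ++ invRev C) := by
        rw [toWord_inv, hd]; simp [invRev_append, invRev_invRev]
      have key : ∀ r' : List (α × Bool), r'.length = r.length →
          code ((invRev p ++ (r' ++ p)).take ((C.length + r.length + C.length) / 2)) <
          code ((C ++ (r' ++ invRev C)).take ((C.length + r.length + C.length) / 2)) := by
        intro r' hr'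
        rw [List.take_append, List.take_append (l₁ := C), List.take_of_length_le (by simp; omega),
          List.take_of_length_le (l := C) (by omega),
          List.take_append_of_le_length (by simp; omega),
          List.take_append_of_le_length (by simp; omega), invRev_length, h1]
        exact code_append_lt h2 _
      rw [weight, weight, initHalf, initHalf, initHalf, initHalf, norm_inv_eq, norm_inv_eq, heq, hnd,
        hw, hwi, hd, hdi, h1]
      have k1 := key r rfl
      have k2 := key (invRev r) invRev_length
      rw [List.append_assoc C r]
      omega

end Weight
end FreeGroup

namespace FreeGroup
variable {α : Type*} [DecidableEq α]

/-- The reduced word of `z` is a conjugate of a letter of sign `b`. -/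
def IsLetterConj (b : Bool) (z : FreeGroup α) : Prop :=
  ∃ U a, toWord z = U ++ [(a, b)] ++ invRev U

theorem exists_toWord_conj_of (g : FreeGroup α) (a : α) :
    ∃ U, toWord (g * of a * g⁻¹) = U ++ [(a, true)] ++ invRev U := by
  induction hn : norm g using Nat.strong_induction_on generalizing g with
  | _ n ih =>
    rcases (toWord g).eq_nil_or_concat with h | ⟨L, l, h⟩
    · rw [toWord_eq_nil_iff] at h
      subst h
      exact ⟨[], by simp [toWord_of]⟩
    · rw [List.concat_eq_append] at h
      have hg : g = mk L * mk [l] := by rw [mul_mk, ← h, mk_toWord]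
      by_cases hl : l.1 = a
      · have e : g * of a * g⁻¹ = mk L * of a * (mk L)⁻¹ := by
          obtain ⟨l1, b⟩ := l
          simp only at hl
          subst hl
          have : mk [(l1, b)] = of l1 ∨ mk [(l1, b)] = (of l1)⁻¹ := by
            cases b
            · right; simp [of, invRev]
            · left; rfl
          rcases this with h' | h' <;> rw [hg, h'] <;> group
        rw [e]
        refine ih (norm (mk L)) ?_ _ rfl
        have h1 : norm (mk L) ≤ L.length := norm_mk_le
        have h2 : norm g = L.length + 1 := by rw [norm, h]; simp
        omega
      · refine ⟨toWord g, ?_⟩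
        have e : g * of a * g⁻¹ = mk (toWord g ++ [(a, true)] ++ invRev (toWord g)) := by
          rw [← mul_mk, ← mul_mk, ← inv_mk, mk_toWord]; rfl
        rw [e, toWord_mk]
        apply IsReduced.reduce_eq
        have r1 : IsReduced (toWord g) := isReduced_toWord
        have r2 : IsReduced (invRev (toWord g)) := by rw [← toWord_inv]; exact isReduced_toWord
        rw [IsReduced] at r1 r2 ⊢
        rw [List.append_assoc, List.isChain_append, List.singleton_append, List.isChain_cons]
        refine ⟨r1, ⟨?_, r2⟩, ?_⟩
        · intro y hy hay
          rw [h] at hy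
          simp [invRev] at hy
          subst hy
          exact absurd hay.symm hl
        · intro y hy z hz hyz
          rw [h] at hy
          simp at hy hz
          subst hy hz
          exact absurd hyz hl

theorem IsLetterConj.inv {b : Bool} {z : FreeGroup α} (h : IsLetterConj b z) :
    IsLetterConj (!b) z⁻¹ := by
  obtain ⟨U, a, h⟩ := h
  exact ⟨U, a, by rw [toWord_inv, h]; rw [invRev_append, invRev_append, invRev_invRev]; simp [invRev]⟩

section Weight
variable [Fintype α]

theorem weight_conj_lt_of_prefix {c d : FreeGroup α} {C p q U : List (α × Bool)} {s : α × Bool}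
    (hc : toWord c⁻¹ = C ++ p) (hd : toWord d = C ++ q) (hU : toWord d = U ++ [s] ++ invRev U)
    (hl : C.length ≤ U.length)
    (h : p.length < C.length ∨ p.length = C.length ∧ code (invRev p) < code C) :
    weight (c * d * c⁻¹) < weight d := by
  have : C <+: U := by
    refine List.prefix_of_prefix_length_le (l₃ := toWord d) ⟨q, hd.symm⟩
      ⟨[s] ++ invRev U, ?_⟩ hl
    rw [hU, List.append_assoc]
  obtain ⟨U', rfl⟩ := this
  refine weight_conj_lt (r := U' ++ [s] ++ invRev U') hc ?_ h
  rw [hU]; simp [invRev_append]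

/-- If neither of two elements can be made smaller by multiplication or conjugation with the other,
then at most half of the first one is cancelled in their product. -/
theorem two_mul_length_cancelled_le {c d : FreeGroup α} {tc td : Prop} {b : Bool}
    (htc : tc → IsLetterConj b c) (htd : td → IsLetterConj b d)
    (h1 : ¬ td → weight d ≤ weight (c * d)) (h2 : td → weight d ≤ weight (c * d * c⁻¹))
    (h3 : ¬ tc → weight c ≤ weight (c * d)) (h4 : tc → weight c ≤ weight (d⁻¹ * c * d)) :
    2 * (cancelled c d).length ≤ norm c := by
  obtain ⟨p, q, hc, hd, -⟩ := commonPrefix_spec (toWord c⁻¹) (toWord d)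
  change _ = cancelled c d ++ _ at hc
  change _ = cancelled c d ++ _ at hd
  generalize cancelled c d = C at hc hd
  have hn : norm c = C.length + p.length := by
    rw [← norm_inv_eq, norm, hc, List.length_append]
  have hnd : norm d = C.length + q.length := by rw [norm, hd, List.length_append]
  by_contra hlt
  have hp : p.length < C.length := by omega
  by_cases hT : td
  · obtain ⟨U, a, hU⟩ := htd hT
    have hnU : norm d = 2 * U.length + 1 := by rw [norm, hU]; simp; omega
    by_cases hCU : C.length ≤ U.length
    · exact (weight_conj_lt_of_prefix hc hd hU hCU (.inl hp)).not_ge (h2 hT)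
    · have hd' : toWord d⁻¹⁻¹ = C ++ q := by rw [inv_inv, hd]
      by_cases hS : tc
      · obtain ⟨Q, a', hQ⟩ := (htc hS).inv
        have hnQ : norm c = 2 * Q.length + 1 := by
          rw [← norm_inv_eq, norm, hQ]; simp; omega
        rcases lt_trichotomy Q.length U.length with hlt | heq | hgt
        · refine (weight_conj_lt_of_prefix (C := C.take (Q.length + 1))
            (p := C.drop (Q.length + 1) ++ p) (q := C.drop (Q.length + 1) ++ q)
            ?_ ?_ hU ?_ ?_).not_ge (h2 hT)
          · rw [hc, ← List.append_assoc, List.take_append_drop]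
          · rw [hd, ← List.append_assoc, List.take_append_drop]
          · simp; omega
          · left; simp; omega
        · have e1 : (toWord c⁻¹)[Q.length]? = some (a', !b) := by
            rw [hQ]; simp
          have e2 : (toWord d)[Q.length]? = some (a, b) := by
            rw [hU, heq]; simp
          rw [hc, List.getElem?_append_left (by omega)] at e1
          rw [hd, List.getElem?_append_left (by omega), e1] at e2
          simp at e2
        · refine absurd (weight_conj_lt_of_prefix (c := d⁻¹) (d := c⁻¹)
            (C := C.take (U.length + 1))
            (p := C.drop (U.length + 1) ++ q) (q := C.drop (U.length + 1) ++ p)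
            ?_ ?_ hQ ?_ ?_) ?_
          · rw [hd', ← List.append_assoc, List.take_append_drop]
          · rw [hc, ← List.append_assoc, List.take_append_drop]
          · simp; omega
          · left; simp; omega
          · rw [weight_inv, inv_inv, show d⁻¹ * c⁻¹ * d = (d⁻¹ * c * d)⁻¹ by group, weight_inv]
            exact (h4 hS).not_gt
      · have := weight_mul_lt (c := d⁻¹) (d := c⁻¹) hd' hc (.inl (by omega))
        rw [← mul_inv_rev, weight_inv, weight_inv] at this
        exact this.not_ge (h3 hS)
  · exact (weight_mul_lt hc hd (.inl hp)).not_ge (h1 hT)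

theorem code_initHalf_le {c d : FreeGroup α} {td : Prop} {b : Bool}
    (htd : td → IsLetterConj b d)
    (h1 : ¬ td → weight d ≤ weight (c * d)) (h2 : td → weight d ≤ weight (c * d * c⁻¹))
    (hkd : 2 * (cancelled c d).length ≤ norm d) (hkc : 2 * (cancelled c d).length = norm c) :
    code (initHalf c⁻¹) ≤ code (initHalf c) := by
  obtain ⟨p, q, hc, hd, -⟩ := commonPrefix_spec (toWord c⁻¹) (toWord d)
  change _ = cancelled c d ++ _ at hc
  change _ = cancelled c d ++ _ at hd
  generalize cancelled c d = C at hc hd hkc hkd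
  have hn : norm c = C.length + p.length := by
    rw [← norm_inv_eq, norm, hc, List.length_append]
  have hnd : norm d = C.length + q.length := by rw [norm, hd, List.length_append]
  have e1 : initHalf c⁻¹ = C := by
    rw [initHalf, hc, norm_inv_eq, List.take_left' (by omega)]
  have e2 : initHalf c = invRev p := by
    rw [initHalf, invRev_toWord_inv, hc, invRev_append, List.take_left' (by simp; omega)]
  rw [e1, e2]
  by_contra hlt
  have hp : p.length = C.length := by omega
  by_cases hT : td
  · obtain ⟨U, a, hU⟩ := htd hT
    have hnU : norm d = 2 * U.length + 1 := by rw [norm, hU]; simp; omega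
    exact (weight_conj_lt_of_prefix hc hd hU (by omega)
      (.inr ⟨by omega, by omega⟩)).not_ge (h2 hT)
  · exact (weight_mul_lt hc hd (.inr ⟨by omega, by omega, by omega⟩)).not_ge (h1 hT)

theorem cancelled_bounds {c d : FreeGroup α} {tc td : Prop}
    (htc : tc → IsLetterConj true c) (htd : td → IsLetterConj true d)
    (h1 : ¬ td → weight d ≤ weight (c * d)) (h2 : td → weight d ≤ weight (c * d * c⁻¹))
    (h3 : ¬ tc → weight c ≤ weight (c * d)) (h4 : tc → weight c ≤ weight (d⁻¹ * c * d)) :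
    2 * (cancelled c d).length ≤ norm c ∧ 2 * (cancelled c d).length ≤ norm d ∧
    (2 * (cancelled c d).length = norm c → code (initHalf c⁻¹) ≤ code (initHalf c)) ∧
    (2 * (cancelled c d).length = norm d → code (initHalf d) ≤ code (initHalf d⁻¹)) := by
  have htc' := fun h => (htc h).inv
  have htd' := fun h => (htd h).inv
  have h1' : ¬ td → weight d⁻¹ ≤ weight (d⁻¹ * c⁻¹) := by
    rw [← mul_inv_rev, weight_inv, weight_inv]; exact h1
  have h2' : td → weight d⁻¹ ≤ weight (c⁻¹⁻¹ * d⁻¹ * c⁻¹) := by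
    rw [show c⁻¹⁻¹ * d⁻¹ * c⁻¹ = (c * d * c⁻¹)⁻¹ by group, weight_inv, weight_inv]; exact h2
  have h3' : ¬ tc → weight c⁻¹ ≤ weight (d⁻¹ * c⁻¹) := by
    rw [← mul_inv_rev, weight_inv, weight_inv]; exact h3
  have h4' : tc → weight c⁻¹ ≤ weight (d⁻¹ * c⁻¹ * d⁻¹⁻¹) := by
    rw [show d⁻¹ * c⁻¹ * d⁻¹⁻¹ = (d⁻¹ * c * d)⁻¹ by group, weight_inv, weight_inv]; exact h4
  have k1 := two_mul_length_cancelled_le htc htd h1 h2 h3 h4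
  have k2 := two_mul_length_cancelled_le (c := d⁻¹) (d := c⁻¹) htd' htc' h3' h4' h1' h2'
  rw [cancelled_inv, norm_inv_eq] at k2
  refine ⟨k1, k2, code_initHalf_le htd h1 h2 k2, ?_⟩
  have k3 := code_initHalf_le (c := d⁻¹) (d := c⁻¹) htc' h3' h4'
  rw [cancelled_inv, norm_inv_eq, norm_inv_eq, inv_inv] at k3
  exact k3 k1

end Weight

/-- A product in which every factor keeps a non-empty middle part after cancellation with its
neighbours. -/
theorem toWord_prod_eq_flatMap (z : ℕ → FreeGroup α) (C s : ℕ → List (α × Bool)) (n : ℕ)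
    (hz : ∀ i < n, toWord (z i) = C i ++ s i ++ invRev (C (i + 1)))
    (hs : ∀ i < n, s i ≠ []) (h0 : C 0 = []) (hn : C n = [])
    (hj : ∀ i, i + 1 < n → ∀ a ∈ (s i).getLast?, ∀ b ∈ (s (i + 1)).head?, a.1 = b.1 → a.2 = b.2) :
    toWord ((List.range n).map z).prod = (List.range n).flatMap s := by
  have h1 : ∀ m ≤ n, ((List.range m).map z).prod = mk ((List.range m).flatMap s) * (mk (C m))⁻¹ := by
    intro m
    induction m with
    | zero => simp [h0, one_eq_mk]
    | succ m ih =>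
      intro hm
      rw [List.range_succ, List.map_append, List.prod_append, ih (by omega), List.flatMap_append]
      simp only [List.map_cons, List.map_nil, List.prod_cons, List.prod_nil, mul_one,
        List.flatMap_cons, List.flatMap_nil, List.append_nil]
      rw [← mk_toWord (x := z m), hz m (by omega), ← mul_mk, ← mul_mk, ← mul_mk, ← inv_mk]
      group
  rw [h1 n le_rfl, hn, ← one_eq_mk, inv_one, mul_one, toWord_mk]
  apply IsReduced.reduce_eq
  rw [IsReduced, List.flatMap, List.isChain_flatten]
  · constructor
    · intro l hl
      simp only [List.mem_map, List.mem_range] at hl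
      obtain ⟨i, hi, rfl⟩ := hl
      have : IsReduced (toWord (z i)) := isReduced_toWord
      rw [hz i hi, IsReduced] at this
      exact (List.isChain_append.1 (List.isChain_append.1 this).1).2.1
    · rw [List.isChain_iff_getElem]
      intro i hi
      simp only [List.length_map, List.length_range] at hi
      simpa using hj i hi
  · intro h
    simp only [List.mem_map, List.mem_range] at h
    obtain ⟨i, hi, h⟩ := h
    exact hs i hi h

end FreeGroup

namespace FreeGroup
variable {α : Type*} [DecidableEq α]

theorem exists_eq_append_append {β : Type*} {L A B x y : List β} (h1 : L = A ++ x) (h2 : L = y ++ B)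
    (h : A.length + B.length ≤ L.length) : ∃ m, L = A ++ m ++ B := by
  have hl : L.length = y.length + B.length := by rw [h2, List.length_append]
  have : A <+: y := List.prefix_of_prefix_length_le ⟨x, h1.symm⟩ ⟨B, h2.symm⟩ (by omega)
  obtain ⟨m, rfl⟩ := this
  exact ⟨m, h2⟩

theorem initHalf_ne {z : FreeGroup α} (hz : z ≠ 1) (he : 2 ∣ norm z) : initHalf z ≠ initHalf z⁻¹ := by
  intro h
  apply hz
  obtain ⟨m, hm⟩ := he
  have h1 : initHalf z⁻¹ = invRev ((toWord z).drop m) := by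
    rw [initHalf, norm_inv_eq, toWord_inv]
    have e : invRev (toWord z) = invRev ((toWord z).drop m) ++ invRev ((toWord z).take m) := by
      rw [← invRev_append, List.take_append_drop]
    rw [e, List.take_left']
    rw [invRev_length, List.length_drop]
    unfold norm at hm ⊢; omega
  rw [h1, initHalf, hm, Nat.mul_div_cancel_left _ two_pos] at h
  rw [← mk_toWord (x := z), ← List.take_append_drop m (toWord z), h, ← mul_mk, ← inv_mk,
    inv_mul_cancel]

/-- If in a product of `n` nontrivial elements each element loses at most half of its word on each
side, with ties broken consistently by `code`, and the product has length at most `n`, then exactly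
one letter of each factor survives. -/
theorem exists_surviving_letters [Fintype α] (z : ℕ → FreeGroup α) {n : ℕ} (hn : 0 < n)
    (hz : ∀ i < n, z i ≠ 1)
    (hb : ∀ i, i + 1 < n →
      2 * (cancelled (z i) (z (i + 1))).length ≤ norm (z i) ∧
      2 * (cancelled (z i) (z (i + 1))).length ≤ norm (z (i + 1)) ∧
      (2 * (cancelled (z i) (z (i + 1))).length = norm (z i) →
        code (initHalf (z i)⁻¹) ≤ code (initHalf (z i))) ∧
      (2 * (cancelled (z i) (z (i + 1))).length = norm (z (i + 1)) →
        code (initHalf (z (i + 1))) ≤ code (initHalf (z (i + 1))⁻¹)))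
    (hw : norm ((List.range n).map z).prod ≤ n) :
    ∃ (k : ℕ → ℕ) (a : ℕ → α × Bool), k 0 = 0 ∧
      toWord ((List.range n).map z).prod = (List.range n).map a ∧
      ∀ i < n, norm (z i) = k i + k (i + 1) + 1 ∧ (toWord (z i))[k i]? = some (a i) ∧
        2 * k i ≤ norm (z i) ∧ 2 * k (i + 1) ≤ norm (z i) ∧
        (2 * k i = norm (z i) → code (initHalf (z i)) < code (initHalf (z i)⁻¹)) ∧
        (2 * k (i + 1) = norm (z i) → code (initHalf (z i)⁻¹) < code (initHalf (z i))) := by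
  set C : ℕ → List (α × Bool) := fun i =>
    if 0 < i ∧ i < n then cancelled (z (i - 1)) (z i) else [] with hC
  have hC0 : C 0 = [] := by simp [hC]
  have hCn : C n = [] := by simp [hC]
  have hCs : ∀ i, i + 1 < n → C (i + 1) = cancelled (z i) (z (i + 1)) := by
    intro i hi; simp [hC, hi]
  have hpos : ∀ i < n, 0 < norm (z i) := fun i hi =>
    Nat.pos_of_ne_zero fun h => hz i hi (norm_eq_zero.1 h)
  have hne : ∀ i < n, 2 ∣ norm (z i) →
      code (initHalf (z i)) ≠ code (initHalf (z i)⁻¹) := fun i hi hd h =>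
    initHalf_ne (hz i hi) hd (eq_of_code_eq (by rw [length_initHalf, length_initHalf, norm_inv_eq]) h)
  have hl : ∀ i < n, 2 * (C i).length ≤ norm (z i) ∧
      (2 * (C i).length = norm (z i) → code (initHalf (z i)) < code (initHalf (z i)⁻¹)) ∧
      ∃ x, toWord (z i) = C i ++ x := by
    intro i hi
    rcases i with _ | i
    · have := hpos 0 hi
      rw [hC0]
      exact ⟨by simp, fun h => by simp at h; omega, _, rfl⟩
    · obtain ⟨-, h1, -, h2⟩ := hb i hi
      rw [hCs i hi]
      refine ⟨h1, fun h => lt_of_le_of_ne (h2 h) (hne _ hi ⟨_, h.symm⟩), ?_⟩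
      obtain ⟨p, q, -, hq, -⟩ := commonPrefix_spec (toWord (z i)⁻¹) (toWord (z (i + 1)))
      exact ⟨q, hq⟩
  have hr : ∀ i < n, 2 * (C (i + 1)).length ≤ norm (z i) ∧
      (2 * (C (i + 1)).length = norm (z i) → code (initHalf (z i)⁻¹) < code (initHalf (z i))) ∧
      ∃ x, toWord (z i) = x ++ invRev (C (i + 1)) := by
    intro i hi
    by_cases hi' : i + 1 < n
    · obtain ⟨h1, -, h2, -⟩ := hb i hi'
      rw [hCs i hi']
      refine ⟨h1, fun h => lt_of_le_of_ne (h2 h) (hne _ hi ⟨_, h.symm⟩).symm, ?_⟩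
      obtain ⟨p, q, hp, -, -⟩ := commonPrefix_spec (toWord (z i)⁻¹) (toWord (z (i + 1)))
      refine ⟨invRev p, ?_⟩
      rw [invRev_toWord_inv, hp, invRev_append]
      rfl
    · have : i + 1 = n := by omega
      have := hpos i hi
      rw [‹i + 1 = n›, hCn]
      exact ⟨by simp, fun h => by simp at h; omega, _, by simp; rfl⟩
  have hsum : ∀ i < n, (C i).length + (C (i + 1)).length < norm (z i) := by
    intro i hi
    obtain ⟨h1, h2, -⟩ := hl i hi
    obtain ⟨h3, h4, -⟩ := hr i hi
    by_contra hcon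
    exact lt_asymm (h2 (by omega)) (h4 (by omega))
  have hs : ∀ i, ∃ m, i < n → toWord (z i) = C i ++ m ++ invRev (C (i + 1)) := by
    intro i
    by_cases hi : i < n
    · obtain ⟨-, -, x, hx⟩ := hl i hi
      obtain ⟨-, -, y, hy⟩ := hr i hi
      obtain ⟨m, hm⟩ := exists_eq_append_append hx hy (by
        rw [invRev_length]; exact (hsum i hi).le)
      exact ⟨m, fun _ => hm⟩
    · exact ⟨[], fun h => absurd h hi⟩
  choose s hs using hs
  have hlen : ∀ i < n, norm (z i) = (C i).length + (s i).length + (C (i + 1)).length := by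
    intro i hi
    rw [norm, hs i hi]; simp [add_assoc]
  have hs1 : ∀ i < n, 1 ≤ (s i).length := by
    intro i hi
    have := hlen i hi
    have := hsum i hi
    omega
  have hprod := toWord_prod_eq_flatMap z C s n hs
    (fun i hi h => by have := hs1 i hi; simp [h] at this) hC0 hCn (by
      intro i hi a ha b hb' hab
      obtain ⟨p, q, hp, hq, hpq⟩ := commonPrefix_spec (toWord (z i)⁻¹) (toWord (z (i + 1)))
      change _ = cancelled (z i) (z (i + 1)) ++ _ at hp
      change _ = cancelled (z i) (z (i + 1)) ++ _ at hq
      rw [hs _ hi, hCs i hi, List.append_assoc, List.append_cancel_left_eq] at hq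
      rw [toWord_inv, hs i (by omega), hCs i hi, invRev_append, invRev_invRev,
        List.append_cancel_left_eq, invRev_append] at hp
      have e1 : (a.1, !a.2) ∈ p.head? := by
        rw [← hp]
        rw [Option.mem_def] at ha
        obtain ⟨l', hl'⟩ := List.getLast?_eq_some_iff.1 ha
        rw [hl']; simp [invRev]
      have e2 : b ∈ q.head? := by
        rw [← hq]
        rw [Option.mem_def] at hb'
        obtain ⟨l', hl'⟩ := List.head?_eq_some_iff.1 hb'
        rw [hl']; simp
      by_contra hne
      apply hpq _ e1 _ e2
      obtain ⟨a1, a2⟩ := a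
      obtain ⟨b1, b2⟩ := b
      simp only at hab hne
      subst hab
      cases a2 <;> cases b2 <;> first | rfl | exact absurd rfl hne)
  have hle : ∑ i ∈ Finset.range n, (s i).length ≤ ∑ i ∈ Finset.range n, 1 := by
    rw [norm, hprod, List.length_flatMap] at hw
    rw [Finset.sum, Finset.range_val, Multiset.range, Multiset.map_coe, Multiset.sum_coe]
    simpa using hw
  have hs2 : ∀ i < n, (s i).length = 1 := by
    intro i hi
    have h := (Finset.sum_eq_sum_iff_of_le (s := Finset.range n) (f := fun _ => 1)
      (g := fun i => (s i).length) (fun i hi => hs1 i (Finset.mem_range.1 hi))).1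
      (le_antisymm (Finset.sum_le_sum fun i hi => hs1 i (Finset.mem_range.1 hi)) hle)
    exact (h i (Finset.mem_range.2 hi)).symm
  have ha : ∀ i, ∃ a, i < n → s i = [a] := by
    intro i
    by_cases hi : i < n
    · obtain ⟨a, ha⟩ := List.length_eq_one_iff.1 (hs2 i hi)
      exact ⟨a, fun _ => ha⟩
    · obtain ⟨a, ha⟩ := List.length_eq_one_iff.1 (hs2 0 hn)
      exact ⟨a, fun h => absurd h hi⟩
  choose a ha using ha
  refine ⟨fun i => (C i).length, a, by simp [hC0], ?_, ?_⟩
  · rw [hprod, List.map_eq_flatMap]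
    exact List.flatMap_congr fun i hi => ha i (List.mem_range.1 hi)
  · intro i hi
    refine ⟨?_, ?_, (hl i hi).1, (hr i hi).1, (hl i hi).2.1, (hr i hi).2.1⟩
    · have := hlen i hi
      have := hs2 i hi
      simp only
      omega
    · rw [hs i hi, ha i hi]; simp

end FreeGroup

namespace SurfaceAut
open FreeGroup

noncomputable instance (g p : ℕ) : DecidableEq (Letter g p) := Classical.decEq _

/-- The letters, as a sum of finite types. -/
def letterEquiv (g p : ℕ) : Letter g p ≃ Fin p ⊕ Fin g ⊕ Fin g where
  toFun
    | .t j => .inl j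
    | .x i => .inr (.inl i)
    | .y i => .inr (.inr i)
  invFun
    | .inl j => .t j
    | .inr (.inl i) => .x i
    | .inr (.inr i) => .y i
  left_inv := by rintro (j | i | i) <;> rfl
  right_inv := by rintro (j | i | i) <;> rfl

noncomputable instance (g p : ℕ) : Fintype (Letter g p) := Fintype.ofEquiv _ (letterEquiv g p).symm

variable {g p : ℕ}

/-- The word of the boundary element. -/
def boundaryList (g p : ℕ) : List (Letter g p × Bool) :=
  (List.finRange p).reverse.map (fun j => (.t j, true)) ++
    (List.finRange g).flatMap fun i => [(.x i, false), (.y i, false), (.x i, true), (.y i, true)]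

/-- The product `[x_1, y_1] ⋯ [x_g, y_g]`. -/
def commProd (g p : ℕ) : F g p := ((List.finRange g).map fun i => comm (x p i) (y p i)).prod

theorem boundaryWord_eq : boundaryWord g p =
    ((List.finRange p).reverse.map (t g)).prod * commProd g p := by
  rw [boundaryWord, commProd, List.ofFn_eq_map, List.ofFn_eq_map, List.map_reverse]

theorem mk_map_t (L : List (Fin p)) :
    mk (L.map fun j => ((.t j, true) : Letter g p × Bool)) = (L.map (t g)).prod := by
  induction L with
  | nil => rfl
  | cons a L ih =>
    rw [List.map_cons, List.map_cons, List.prod_cons, ← ih, t, of, mul_mk]; rfl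

theorem mk_boundaryList : mk (boundaryList g p) = boundaryWord g p := by
  rw [boundaryWord_eq, boundaryList, ← mul_mk, mk_map_t, commProd]
  congr 1
  induction List.finRange g with
  | nil => rfl
  | cons a L ih =>
    rw [List.flatMap_cons, List.map_cons, List.prod_cons, ← ih, ← mul_mk]
    congr 1

theorem mem_boundaryList_t {j : Fin p} {b : Bool} :
    ((.t j, b) : Letter g p × Bool) ∈ boundaryList g p ↔ b = true := by
  simp [boundaryList, eq_comm]

theorem mem_boundaryList_x {i : Fin g} {b : Bool} :
    ((.x i, b) : Letter g p × Bool) ∈ boundaryList g p := by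
  cases b <;> simp [boundaryList]

theorem mem_boundaryList_y {i : Fin g} {b : Bool} :
    ((.y i, b) : Letter g p × Bool) ∈ boundaryList g p := by
  cases b <;> simp [boundaryList]

theorem nodup_boundaryList : (boundaryList g p).Nodup := by
  rw [boundaryList, List.nodup_append]
  refine ⟨?_, ?_, ?_⟩
  · refine List.Nodup.map ?_ (List.nodup_reverse.2 (List.nodup_finRange p))
    intro a b h
    simpa using h
  · rw [List.nodup_flatMap]
    refine ⟨fun i _ => by simp, ?_⟩
    refine (List.nodup_finRange g).imp ?_
    intro a b hab
    simp [Function.onFun, List.disjoint_left, hab]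
  · simp only [List.mem_map, List.mem_flatMap]
    rintro _ ⟨j, -, rfl⟩ _ ⟨i, -, h⟩ rfl
    simp at h

theorem length_boundaryList : (boundaryList g p).length = p + 4 * g := by
  simp [boundaryList, List.length_flatMap, mul_comm]

/-- A function on the corners of the boundary word which vanishes at the base point and is
compatible with the gluing of the edges vanishes: all corners are glued to one vertex. -/
theorem eq_zero_of_glued {k : ℕ → ℕ} (h0 : k 0 = 0)
    (ht : ∀ (i : ℕ) (j : Fin p), (boundaryList g p)[i]? = some (.t j, true) → k i = k (i + 1))
    (hg : ∀ (i j : ℕ) l b, (boundaryList g p)[i]? = some (l, b) →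
      (boundaryList g p)[j]? = some (l, !b) → k i = k (j + 1)) :
    ∀ i ≤ (boundaryList g p).length, k i = 0 := by
  have h1 : ∀ i ≤ p, k i = 0 := by
    intro i hi
    induction i with
    | zero => exact h0
    | succ i ih =>
      rw [← ht i ((List.finRange p).reverse[i]'(by simp; omega)) ?_, ih (by omega)]
      rw [boundaryList, List.getElem?_append_left (by simp; omega), List.getElem?_map,
        List.getElem?_eq_getElem (by simp; omega)]
      rfl
  have h2 : ∀ m ≤ g, ∀ i ≤ p + 4 * m, k i = 0 := by
    intro m hm
    induction m with
    | zero => simpa using h1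
    | succ m ih =>
      have hget : ∀ r, r < 4 → (boundaryList g p)[p + 4 * m + r]? =
          ([(.x ⟨m, hm⟩, false), (.y ⟨m, hm⟩, false), (.x ⟨m, hm⟩, true),
            (.y ⟨m, hm⟩, true)] : List (Letter g p × Bool))[r]? := by
        intro r hr
        have hs : List.finRange g = (List.finRange g).take m ++ ⟨m, hm⟩ ::
            (List.finRange g).drop (m + 1) := by
          conv_lhs => rw [← List.take_append_drop m (List.finRange g),
            List.drop_eq_getElem_cons (by simpa using hm)]
          simp
        rw [boundaryList, hs, List.flatMap_append, List.flatMap_cons]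
        rw [List.getElem?_append_right (by simp; omega), List.getElem?_append_right
          (by simp [List.length_flatMap]; omega), List.getElem?_append_left
          (by simp [List.length_flatMap]; omega)]
        congr 1
        simp [List.length_flatMap]
        omega
      have ih' := ih (by omega)
      have a0 := ih' (p + 4 * m) le_rfl
      have e0 := hget 0 (by omega)
      have e1 := hget 1 (by omega)
      have e2 := hget 2 (by omega)
      have e3 := hget 3 (by omega)
      have c1 := hg _ _ _ _ e0 e2
      have c2 := hg _ _ _ _ e2 e0
      have c3 := hg _ _ _ _ e1 e3
      have c4 := hg _ _ _ _ e3 e1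
      simp only [add_zero, add_assoc] at c1 c2 c3 c4 a0
      norm_num at c1 c2 c3 c4
      intro i hi
      rcases Nat.lt_or_ge (p + 4 * m) i with hlt | hge
      · obtain ⟨r, rfl⟩ := Nat.exists_eq_add_of_lt hlt
        have : r = 0 ∨ r = 1 ∨ r = 2 ∨ r = 3 := by omega
        rcases this with rfl | rfl | rfl | rfl <;> simp only [add_assoc] <;> norm_num <;> omega
      · exact ih' i hge
  intro i hi
  rw [length_boundaryList] at hi
  exact h2 g le_rfl i hi

/-- The automorphisms that permute the conjugacy classes of the `t_j`. -/
def permutesT (g p : ℕ) : Subgroup (MulAut (F g p)) where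
  carrier := {φ | ConjClasses.map φ.toMonoidHom '' tClasses g p = tClasses g p}
  one_mem' := by
    have h : ConjClasses.map (1 : MulAut (F g p)).toMonoidHom = id := by
      funext c
      induction c using Quotient.inductionOn
      rfl
    rw [Set.mem_ofPred_eq, h, Set.image_id]
  mul_mem' := by
    rintro φ ψ h₂ h₄
    have h : ConjClasses.map (φ * ψ).toMonoidHom =
        ConjClasses.map φ.toMonoidHom ∘ ConjClasses.map ψ.toMonoidHom := by
      funext c
      induction c using Quotient.inductionOn
      rfl
    rw [Set.mem_ofPred_eq] at *
    rw [h, Set.image_comp, h₄, h₂]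
  inv_mem' := by
    rintro φ h₂
    have h : ConjClasses.map (φ⁻¹).toMonoidHom ∘ ConjClasses.map φ.toMonoidHom = id := by
      funext c
      induction c using Quotient.inductionOn with
      | h a => exact congrArg ConjClasses.mk (MulAut.inv_apply_self _ φ a)
    rw [Set.mem_ofPred_eq] at *
    conv_lhs => rw [← h₂]
    rw [← Set.image_comp, h, Set.image_id]

theorem mem_A {φ : MulAut (F g p)} :
    φ ∈ A g p ↔ φ (boundaryWord g p) = boundaryWord g p ∧ φ ∈ permutesT g p := Iff.rfl

theorem mem_permutesT {φ : MulAut (F g p)} (e : Equiv.Perm (Fin p))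
    (h : ∀ j, IsConj (t g (e j)) (φ (t g j))) : φ ∈ permutesT g p := by
  change _ '' _ = _
  rw [tClasses, ← Set.range_comp]
  have : (ConjClasses.map φ.toMonoidHom ∘ fun j => ConjClasses.mk (t g j)) =
      (fun j => ConjClasses.mk (t g j)) ∘ e := by
    funext j
    exact (ConjClasses.mk_eq_mk_iff_isConj.2 (h j)).symm
  rw [this, e.surjective.range_comp]

theorem exists_isConj_of_mem_permutesT {φ : MulAut (F g p)} (h : φ ∈ permutesT g p) (j : Fin p) :
    ∃ k, IsConj (t g k) (φ (t g j)) := by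
  change _ '' _ = _ at h
  have : ConjClasses.map φ.toMonoidHom (ConjClasses.mk (t g j)) ∈ tClasses g p := by
    rw [← h]; exact ⟨_, ⟨j, rfl⟩, rfl⟩
  obtain ⟨k, hk⟩ := this
  exact ⟨k, ConjClasses.mk_eq_mk_iff_isConj.1 hk⟩

/-- The endomorphism killing all `t_j`. -/
def killT (g p : ℕ) : F g p →* F g p :=
  FreeGroup.lift fun
    | .t _ => 1
    | .x i => x p i
    | .y i => y p i

@[simp] theorem killT_t (j : Fin p) : killT g p (t g j) = 1 := by simp [killT, t]
@[simp] theorem killT_x (i : Fin g) : killT g p (x p i) = x p i := by simp [killT, x]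
@[simp] theorem killT_y (i : Fin g) : killT g p (y p i) = y p i := by simp [killT, y]

theorem hom_ext_letters {G : Type*} [Group G] {f h : F g p →* G} (h1 : ∀ j, f (t g j) = h (t g j))
    (h2 : ∀ i, f (x p i) = h (x p i)) (h3 : ∀ i, f (y p i) = h (y p i)) : f = h := by
  ext a
  rcases a with j | i | i
  exacts [h1 j, h2 i, h3 i]

theorem map_eq_one_of_isConj {G H : Type*} [Group G] [Group H] (f : G →* H) {a b : G}
    (h : IsConj a b) (ha : f a = 1) : f b = 1 := by
  obtain ⟨c, rfl⟩ := isConj_iff.1 h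
  simp [ha]

theorem killT_apply_t {φ : MulAut (F g p)} (h : φ ∈ permutesT g p) (j : Fin p) :
    killT g p (φ (t g j)) = 1 := by
  obtain ⟨k, hk⟩ := exists_isConj_of_mem_permutesT h j
  exact map_eq_one_of_isConj _ hk (killT_t k)

theorem killT_commProd : killT g p (commProd g p) = commProd g p := by
  rw [commProd, map_list_prod, List.map_map]
  refine congrArg List.prod (List.map_congr_left fun i _ => ?_)
  simp [comm]

theorem killT_boundaryWord : killT g p (boundaryWord g p) = commProd g p := by
  rw [boundaryWord_eq, _root_.map_mul, killT_commProd, map_list_prod, List.map_map]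
  rw [List.prod_eq_one, one_mul]
  simp

end SurfaceAut

namespace SurfaceAut
open FreeGroup
variable {g p : ℕ}

/-- The subscripts of the letters `t_j` of a word, in order. -/
def tIndices (V : List (Letter g p × Bool)) : List (Fin p) :=
  V.filterMap fun a => match a.1 with
    | .t j => some j
    | _ => none

theorem tIndices_append (V V' : List (Letter g p × Bool)) :
    tIndices (V ++ V') = tIndices V ++ tIndices V' := List.filterMap_append

@[simp] theorem tIndices_cons_t (j : Fin p) (b : Bool) (V : List (Letter g p × Bool)) :
    tIndices ((.t j, b) :: V) = j :: tIndices V := rfl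

theorem tIndices_boundaryList : tIndices (boundaryList g p) = (List.finRange p).reverse := by
  have : ∀ L : List (Fin g), tIndices (L.flatMap fun i => [((.x i, false) : Letter g p × Bool),
      (.y i, false), (.x i, true), (.y i, true)]) = [] := by
    intro L
    induction L with
    | nil => rfl
    | cons a L ih => rw [List.flatMap_cons, tIndices_append, ih]; rfl
  rw [boundaryList, tIndices_append, this, List.append_nil, tIndices, List.filterMap_map]
  exact List.filterMap_some

/-- `ψ` carries the word `V` to the boundary word, permutes the classes of the `t_j`, and `V` has
the same letters as the boundary word. -/
structure IsMarking (V : List (Letter g p × Bool)) (ψ : MulAut (F g p)) : Prop where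
  intro ::
  perm : V.Perm (boundaryList g p)
  mem : ψ ∈ permutesT g p
  map_mk : ψ (mk V) = boundaryWord g p

theorem IsMarking.nodup {V : List (Letter g p × Bool)} {ψ : MulAut (F g p)} (h : IsMarking V ψ) :
    V.Nodup := h.perm.nodup_iff.2 nodup_boundaryList

theorem IsMarking.mem_t {V : List (Letter g p × Bool)} {ψ : MulAut (F g p)} (h : IsMarking V ψ)
    {j : Fin p} {b : Bool} : (.t j, b) ∈ V ↔ b = true :=
  h.perm.mem_iff.trans mem_boundaryList_t

/-- The element `P t_j P⁻¹`, for a prefix `P` of a word followed by `t_j`. -/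
def front (P : List (Letter g p × Bool)) (j : Fin p) : F g p := mk P * t g j * (mk P)⁻¹

theorem exists_perm_of_isMarking {V : List (Letter g p × Bool)} {ψ : MulAut (F g p)}
    (h : IsMarking V ψ) :
    ∃ e : Equiv.Perm (Fin p), (tIndices V).map e = (List.finRange p).reverse := by
  have hp : (tIndices V).Perm (List.finRange p).reverse := by
    rw [← tIndices_boundaryList (g := g)]
    exact h.perm.filterMap _
  have hl : (tIndices V).length = p := by rw [hp.length_eq]; simp
  have hn : (tIndices V).Nodup := hp.nodup_iff.2 (List.nodup_reverse.2 (List.nodup_finRange p))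
  have hm : ∀ j, j ∈ tIndices V := fun j => hp.mem_iff.2 (by simp)
  let f : Fin p → Fin p := fun i => (tIndices V).get (i.cast hl.symm)
  have hf : Function.Bijective f := by
    rw [Fintype.bijective_iff_injective_and_card]
    refine ⟨fun a b hab => ?_, rfl⟩
    have := List.nodup_iff_injective_get.1 hn hab
    simpa [Fin.ext_iff] using this
  refine ⟨(Equiv.ofBijective f hf).symm.trans Fin.revPerm, ?_⟩
  have : tIndices V = (List.finRange p).map f := by
    apply List.ext_getElem
    · simp [hl]
    · intro i h1 h2; simp [f]
  rw [this, List.map_map, List.finRange_reverse]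
  apply List.map_congr_left
  intro i _
  simp

theorem exists_normalization {V : List (Letter g p × Bool)} {ψ : MulAut (F g p)}
    (h : IsMarking V ψ) :
    ∃ β : MulAut (F g p), β ∈ permutesT g p ∧ β (mk V) = boundaryWord g p ∧
      ∀ P j Q, V = P ++ (.t j, true) :: Q → ∃ A i B, (List.finRange p).reverse = A ++ i :: B ∧
        β (front P j) = (A.map (t g)).prod * t g i * ((A.map (t g)).prod)⁻¹ := by
  obtain ⟨e, he⟩ := exists_perm_of_isMarking h
  have hψ := h.mem
  have hψ' : ψ⁻¹ ∈ permutesT g p := inv_mem hψ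
  set pre : Fin p → F g p := fun j => mk (V.takeWhile fun a => decide (a ≠ (.t j, true))) with hpre
  have pre_eq : ∀ P j Q, V = P ++ (.t j, true) :: Q → pre j = mk P := by
    intro P j Q hV
    have hn := h.nodup
    rw [hV, List.nodup_append] at hn
    simp only [hpre]
    rw [hV, List.takeWhile_append_of_pos]
    · simp
    · intro a ha
      have := hn.2.2 a ha (.t j, true) (by simp)
      simpa using this
  let b : F g p →* F g p := FreeGroup.lift fun
    | .t j => (killT g p (ψ (pre j)))⁻¹ * t g (e j) * killT g p (ψ (pre j))
    | .x i => killT g p (ψ (x p i))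
    | .y i => killT g p (ψ (y p i))
  let b' : F g p →* F g p := FreeGroup.lift fun
    | .t j => killT g p (pre (e.symm j)) * t g (e.symm j) * (killT g p (pre (e.symm j)))⁻¹
    | .x i => killT g p (ψ⁻¹ (x p i))
    | .y i => killT g p (ψ⁻¹ (y p i))
  have bt : ∀ j, b (t g j) = (killT g p (ψ (pre j)))⁻¹ * t g (e j) * killT g p (ψ (pre j)) :=
    fun j => by simp [b, t]
  have bx : ∀ i, b (x p i) = killT g p (ψ (x p i)) := fun j => by simp [b, x]
  have bY : ∀ i, b (y p i) = killT g p (ψ (y p i)) := fun j => by simp [b, y]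
  have bt' : ∀ j, b' (t g j) =
      killT g p (pre (e.symm j)) * t g (e.symm j) * (killT g p (pre (e.symm j)))⁻¹ :=
    fun j => by simp [b', t]
  have bx' : ∀ i, b' (x p i) = killT g p (ψ⁻¹ (x p i)) := fun j => by simp [b', x]
  have bY' : ∀ i, b' (y p i) = killT g p (ψ⁻¹ (y p i)) := fun j => by simp [b', y]
  have hb : ∀ z, b (killT g p z) = killT g p (ψ z) := by
    intro z
    have : b.comp (killT g p) = (killT g p).comp ψ.toMonoidHom :=
      hom_ext_letters (by simp [killT_apply_t hψ]) (by simp [bx]) (by simp [bY])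
    exact DFunLike.congr_fun this z
  have hb' : ∀ z, b' (killT g p z) = killT g p (ψ⁻¹ z) := by
    intro z
    have : b'.comp (killT g p) = (killT g p).comp (ψ⁻¹).toMonoidHom := by
      refine hom_ext_letters (fun j => ?_) (by simp [bx']) (by simp [bY'])
      simpa using (killT_apply_t hψ' j).symm
    exact DFunLike.congr_fun this z
  let β : MulAut (F g p) := MonoidHom.toMulEquiv b b'
    (by
      refine hom_ext_letters (fun j => ?_) (fun i => ?_) (fun i => ?_)
      · simp only [MonoidHom.comp_apply, bt, _root_.map_mul, _root_.map_inv, hb', bt', MulAut.inv_apply_self,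
          Equiv.symm_apply_apply, MonoidHom.id_apply]
        group
      · simp [bx, hb']
      · simp [bY, hb'])
    (by
      refine hom_ext_letters (fun j => ?_) (fun i => ?_) (fun i => ?_)
      · simp only [MonoidHom.comp_apply, bt, _root_.map_mul, _root_.map_inv, hb, bt',
          Equiv.apply_symm_apply, MonoidHom.id_apply]
        group
      · rw [MonoidHom.comp_apply, bx', hb, MulAut.apply_inv_self]; simp
      · rw [MonoidHom.comp_apply, bY', hb, MulAut.apply_inv_self]; simp)
  have key : ∀ P Q, V = P ++ Q →
      b (mk P) = (((tIndices P).map e).map (t g)).prod * killT g p (ψ (mk P)) := by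
    intro P
    induction P using List.reverseRecOn with
    | nil => intro Q _; simp [← one_eq_mk, tIndices]
    | append_singleton P a ih =>
      intro Q hV
      have hV' : V = P ++ a :: Q := by rw [hV]; simp
      have ih := ih _ hV'
      rw [← mul_mk, _root_.map_mul, ih, tIndices_append, _root_.map_mul, _root_.map_mul]
      obtain ⟨a1, s⟩ := a
      have sgn : ∀ v : Letter g p, mk [(v, s)] = of v ∨ mk [(v, s)] = (of v)⁻¹ := by
        intro v
        cases s
        · right; simp [of, invRev]
        · left; rfl
      rcases a1 with j | i | i
      · have hs : s = true := (h.mem_t (j := j)).1 (by rw [hV']; simp)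
        subst hs
        have e1 : mk [((.t j, true) : Letter g p × Bool)] = t g j := rfl
        rw [e1, bt, killT_apply_t hψ, pre_eq _ _ _ hV']
        simp [tIndices]
        group
      · have e2 : tIndices [((.x i, s) : Letter g p × Bool)] = [] := rfl
        have e3 : b (mk [(.x i, s)]) = killT g p (ψ (mk [(.x i, s)])) := by
          have := bx i
          unfold x at this
          rcases sgn (.x i) with h' | h' <;> rw [h'] <;> simp only [_root_.map_inv, this]
        rw [e2, e3]; simp [mul_assoc]
      · have e2 : tIndices [((.y i, s) : Letter g p × Bool)] = [] := rfl
        have e3 : b (mk [(.y i, s)]) = killT g p (ψ (mk [(.y i, s)])) := by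
          have := bY i
          unfold y at this
          rcases sgn (.y i) with h' | h' <;> rw [h'] <;> simp only [_root_.map_inv, this]
        rw [e2, e3]; simp [mul_assoc]
  refine ⟨β, ?_, ?_, ?_⟩
  · refine mem_permutesT e fun j => ?_
    rw [isConj_iff]
    refine ⟨(killT g p (ψ (pre j)))⁻¹, ?_⟩
    change _ = b (t g j)
    rw [bt]; group
  · change b (mk V) = _
    rw [key V [] (by simp), he, h.map_mk, killT_boundaryWord, boundaryWord_eq]
  · intro P j Q hV
    refine ⟨(tIndices P).map e, e j, (tIndices Q).map e, ?_, ?_⟩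
    · rw [← he, hV, tIndices_append, tIndices_cons_t, List.map_append, List.map_cons]
    · change b (front P j) = _
      rw [front, _root_.map_mul, _root_.map_mul, _root_.map_inv, key P _ hV, bt,
        pre_eq _ _ _ hV]
      group

theorem pred_lt_of_two_le (hp : 2 ≤ p) : p - 1 < p := by omega

/-- The subgroup generated by the stabilizer of `t_p` and the last braid twist. -/
def stabTwist (g p : ℕ) (hp : 2 ≤ p) : Subgroup (MulAut (F g p)) :=
  Subgroup.closure ((stabA (t g (⟨p - 1, pred_lt_of_two_le hp⟩ : Fin p)) : Set (MulAut (F g p))) ∪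
    {sigma g p p hp le_rfl})

theorem twist_apply (k l : Fin p) (hkl : k ≠ l) (z : F g p) :
    twist g k l hkl z = twistHom g k l z := rfl

theorem twist_inv_apply (k l : Fin p) (hkl : k ≠ l) (z : F g p) :
    (twist g k l hkl)⁻¹ z = twistInvHom g k l z := rfl

theorem twist_mem_A (k l : Fin p) (hkl : k ≠ l) (h : (k : ℕ) = l + 1) : twist g k l hkl ∈ A g p := by
  have ht : ∀ j, twist g k l hkl (t g j) =
      if j = k then t g l else if j = l then (t g l)⁻¹ * t g k * t g l else t g j := fun j => by
    rw [twist_apply]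
    simp [twistHom, t]
  have hx : ∀ i, twist g k l hkl (x p i) = x p i := fun i => by
    rw [twist_apply]
    simp [twistHom, x]
  have hy : ∀ i, twist g k l hkl (y p i) = y p i := fun i => by
    rw [twist_apply]
    simp [twistHom, y]
  refine mem_A.2 ⟨?_, ?_⟩
  · have hc : twist g k l hkl (commProd g p) = commProd g p := by
      rw [commProd, map_list_prod, List.map_map]
      refine congrArg List.prod (List.map_congr_left fun i _ => ?_)
      simp [comm, hx, hy]
    rw [boundaryWord_eq, _root_.map_mul, hc]
    congr 1
    have hl : (l : ℕ) < p := l.2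
    have hk : (k : ℕ) < p := k.2
    have hs : List.finRange p = (List.finRange p).take l ++ l :: k :: (List.finRange p).drop (l + 2) := by
      conv_lhs => rw [← List.take_append_drop l (List.finRange p),
        List.drop_eq_getElem_cons (by simp),
        List.drop_eq_getElem_cons (by simp; omega)]
      simp
      exact Fin.ext h.symm
    have hn := List.nodup_finRange p
    rw [hs] at hn
    rw [hs]
    generalize (List.finRange p).take l = X at hn
    generalize (List.finRange p).drop (l + 2) = Y at hn
    have fix : ∀ L : List (Fin p), k ∉ L → l ∉ L →
        twist g k l hkl ((L.map (t g)).prod) = (L.map (t g)).prod := by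
      intro L h1 h2
      rw [map_list_prod, List.map_map]
      congr 1
      apply List.map_congr_left
      intro j hj
      have a1 : j ≠ k := fun h => h1 (h ▸ hj)
      have a2 : j ≠ l := fun h => h2 (h ▸ hj)
      simp [ht, a1, a2]
    simp only [List.nodup_append, List.nodup_cons] at hn
    have hX1 : k ∉ X := fun hk => hn.2.2 k hk k (by simp) rfl
    have hX2 : l ∉ X := fun hk => hn.2.2 l hk l (by simp) rfl
    have hY1 : k ∉ Y := hn.2.1.2.1
    have hY2 : l ∉ Y := fun hl => hn.2.1.1 (by simp [hl])
    simp only [List.reverse_append, List.reverse_cons, List.map_append, List.prod_append, List.map_cons,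
      List.map_nil, List.prod_cons, List.prod_nil, mul_one, _root_.map_mul]
    rw [fix _ (by simpa) (by simpa), fix _ (by simpa) (by simpa), ht, ht]
    simp [hkl.symm]
    group
  · refine mem_permutesT (Equiv.swap k l) fun j => ?_
    rw [ht]
    by_cases h1 : j = k
    · subst h1
      simp only [Equiv.swap_apply_left, if_true]
      exact IsConj.refl _
    · by_cases h2 : j = l
      · subst h2
        simp only [h1, if_false, Equiv.swap_apply_right, if_true]
        rw [isConj_iff]
        exact ⟨(t g j)⁻¹, by group⟩
      · simp only [h1, h2, if_false, Equiv.swap_apply_of_ne_of_ne h1 h2]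
        exact IsConj.refl _

theorem stabTwist_le_A (hp : 2 ≤ p) : stabTwist g p hp ≤ A g p := by
  rw [stabTwist, Subgroup.closure_le]
  rintro φ (h | h)
  · exact h.1
  · rw [Set.mem_singleton_iff] at h
    subst h
    exact twist_mem_A _ _ _ (by simp; omega)

theorem mem_stabTwist_of_apply {hp : 2 ≤ p} {φ : MulAut (F g p)} (h : φ ∈ A g p)
    (h1 : φ (t g ⟨p - 1, pred_lt_of_two_le hp⟩) = t g ⟨p - 1, pred_lt_of_two_le hp⟩) : φ ∈ stabTwist g p hp :=
  Subgroup.subset_closure (.inl ⟨h, h1⟩)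

/-- The orbit of `t_p` under the subgroup generated by its stabilizer and the last braid twist. -/
def tOrbit (g p : ℕ) (hp : 2 ≤ p) : Set (F g p) :=
  {z | ∃ φ ∈ stabTwist g p hp, φ (t g ⟨p - 1, pred_lt_of_two_le hp⟩) = z}

theorem apply_mem_tOrbit {hp : 2 ≤ p} {φ : MulAut (F g p)} (h : φ ∈ stabTwist g p hp) {z : F g p}
    (hz : z ∈ tOrbit g p hp) : φ z ∈ tOrbit g p hp := by
  obtain ⟨χ, hχ, rfl⟩ := hz
  exact ⟨φ * χ, mul_mem h hχ, rfl⟩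

theorem mem_stabTwist_of_apply_mem_tOrbit {hp : 2 ≤ p} {φ : MulAut (F g p)} (h : φ ∈ A g p)
    {z : F g p} (hz : z ∈ tOrbit g p hp) (hφ : φ z ∈ tOrbit g p hp) : φ ∈ stabTwist g p hp := by
  obtain ⟨χ, hχ, rfl⟩ := hz
  obtain ⟨ρ, hρ, e⟩ := hφ
  have h1 : ρ⁻¹ * φ * χ ∈ stabTwist g p hp := by
    refine mem_stabTwist_of_apply (mul_mem (mul_mem (inv_mem (stabTwist_le_A hp hρ)) h)
      (stabTwist_le_A hp hχ)) ?_
    rw [MulAut.mul_apply, MulAut.mul_apply, ← e, MulAut.inv_apply_self]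
  have : φ = ρ * (ρ⁻¹ * φ * χ) * χ⁻¹ := by group
  rw [this]
  exact mul_mem (mul_mem hρ h1) (inv_mem hχ)

theorem twist_mem_stabTwist {hp : 2 ≤ p} (k l : Fin p) (hkl : k ≠ l) (h : (k : ℕ) = l + 1) :
    twist g k l hkl ∈ stabTwist g p hp := by
  by_cases hk : (k : ℕ) = p - 1
  · apply Subgroup.subset_closure
    right
    rw [Set.mem_singleton_iff, sigma]
    obtain ⟨k, hk'⟩ := k
    obtain ⟨l, hl'⟩ := l
    simp only at h hk
    subst hk
    have : l = p - 2 := by omega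
    subst this
    rfl
  · refine mem_stabTwist_of_apply (twist_mem_A k l hkl h) ?_
    rw [twist_apply]
    have h1 : (⟨p - 1, pred_lt_of_two_le hp⟩ : Fin p) ≠ k := fun e => hk (by rw [← e])
    have h2 : (⟨p - 1, pred_lt_of_two_le hp⟩ : Fin p) ≠ l := fun e => by
      have := k.2; have : (l : ℕ) = p - 1 := by rw [← e]
      omega
    simp [twistHom, t, h1, h2]

theorem conj_prod_t_mem_tOrbit (hp : 2 ≤ p) {A : List (Fin p)} {i : Fin p} {B : List (Fin p)}
    (h : (List.finRange p).reverse = A ++ i :: B) :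
    (A.map (t g)).prod * t g i * ((A.map (t g)).prod)⁻¹ ∈ tOrbit g p hp := by
  induction A using List.reverseRecOn generalizing i B with
  | nil =>
    have : ((List.finRange p).reverse)[0]? = some i := by rw [h]; rfl
    rw [List.getElem?_eq_getElem (by simp; omega)] at this
    simp at this
    refine ⟨1, one_mem _, ?_⟩
    subst this
    simp
  | append_singleton A k ih =>
    have h' : (List.finRange p).reverse = A ++ k :: (i :: B) := by rw [h]; simp
    have ih := ih h'
    have ek : ((List.finRange p).reverse)[A.length]? = some k := by rw [h']; simp
    have ei : ((List.finRange p).reverse)[A.length + 1]? = some i := by rw [h]; simp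
    have hlen := congrArg List.length h'
    simp at hlen
    rw [List.getElem?_eq_getElem (by simp; omega)] at ek ei
    simp at ek ei
    have hki : (k : ℕ) = i + 1 := by
      rw [← ek, ← ei]; simp; omega
    have hne : k ≠ i := fun e => by rw [e] at hki; omega
    have hn := List.nodup_reverse.2 (List.nodup_finRange p)
    rw [h'] at hn
    simp only [List.nodup_append, List.nodup_cons] at hn
    have ht : ∀ j, (twist g k i hne)⁻¹ (t g j) =
        if j = i then t g k else if j = k then t g k * t g i * (t g k)⁻¹ else t g j := fun j => by
      rw [twist_inv_apply]
      simp [twistInvHom, t]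
    have fix : (twist g k i hne)⁻¹ ((A.map (t g)).prod) = (A.map (t g)).prod := by
      rw [map_list_prod, List.map_map]
      congr 1
      apply List.map_congr_left
      intro j hj
      have a1 : j ≠ k := hn.2.2 j hj k (by simp)
      have a2 : j ≠ i := hn.2.2 j hj i (by simp)
      rw [Function.comp_apply, ht]
      simp [a1, a2]
    have := apply_mem_tOrbit (inv_mem (twist_mem_stabTwist (g := g) (hp := hp) k i hne hki)) ih
    rw [_root_.map_mul, _root_.map_mul, _root_.map_inv, fix, ht] at this
    simp only [hne, if_false, if_true] at this
    convert this using 1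
    simp
    group

/-- If one front of a marking lies in the orbit of `t_p`, then all of them do. -/
theorem IsMarking.front_mem_tOrbit {hp : 2 ≤ p} {V : List (Letter g p × Bool)} {ψ : MulAut (F g p)}
    (h : IsMarking V ψ) {P Q : List (Letter g p × Bool)} {j : Fin p}
    (hV : V = P ++ (.t j, true) :: Q) (hf : ψ (front P j) ∈ tOrbit g p hp)
    {P' Q' : List (Letter g p × Bool)} {j' : Fin p} (hV' : V = P' ++ (.t j', true) :: Q') :
    ψ (front P' j') ∈ tOrbit g p hp := by
  obtain ⟨β, hβ, hβV, hβf⟩ := exists_normalization h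
  have key : ∀ P j Q, V = P ++ (.t j, true) :: Q → β (front P j) ∈ tOrbit g p hp := by
    intro P j Q hV
    obtain ⟨A, i, B, hA, e⟩ := hβf P j Q hV
    rw [e]
    exact conj_prod_t_mem_tOrbit hp hA
  have e : ∀ z, (ψ * β⁻¹) (β z) = ψ z := fun z => by
    rw [MulAut.mul_apply, MulAut.inv_apply_self]
  have hA : ψ * β⁻¹ ∈ A g p :=
    mem_A.2 ⟨by rw [← hβV, e, h.map_mk, hβV], mul_mem h.mem (inv_mem hβ)⟩
  have := mem_stabTwist_of_apply_mem_tOrbit hA (key P j Q hV) (by rw [e]; exact hf)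
  rw [← e]
  exact apply_mem_tOrbit this (key _ _ _ hV')

end SurfaceAut

namespace FreeGroup

section
variable {α : Type*}

/-- The inverse of a signed letter. -/
def flipSign (d : α × Bool) : α × Bool := (d.1, !d.2)

theorem mk_flipSign (d : α × Bool) : mk [flipSign d] = (mk [d])⁻¹ := by
  rw [inv_mk]; rfl

@[simp] theorem flipSign_flipSign (d : α × Bool) : flipSign (flipSign d) = d := by simp [flipSign]

theorem flipSign_ne (d : α × Bool) : flipSign d ≠ d := by
  intro h
  have := congrArg Prod.snd h
  simp [flipSign] at this

theorem eq_or_eq_flipSign {a d : α × Bool} (h : a.1 = d.1) : a = d ∨ a = flipSign d := by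
  obtain ⟨a1, a2⟩ := a
  obtain ⟨d1, d2⟩ := d
  simp only at h
  subst h
  cases a2 <;> cases d2 <;> simp [flipSign]

theorem mk_singleton_eq (d : α × Bool) : mk [d] = of d.1 ∨ mk [d] = (of d.1)⁻¹ := by
  obtain ⟨d, s⟩ := d
  cases s
  · right; simp [of, invRev]
  · left; rfl

theorem mk_cons_eq_mul (a : α × Bool) (L : List (α × Bool)) : mk (a :: L) = mk [a] * mk L := by
  rw [mul_mk]; rfl

theorem mk_cons_cons (a b : α × Bool) (L : List (α × Bool)) :
    mk (a :: b :: L) = mk [a] * mk (b :: L) := mk_cons_eq_mul _ _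

theorem mk_cons_append (a : α × Bool) (L M : List (α × Bool)) :
    mk (a :: (L ++ M)) = mk [a] * (mk L * mk M) := by rw [mk_cons_eq_mul, mul_mk (L₁ := L)]

theorem apply_mk_of_fixes {a : α} {τ : MulAut (FreeGroup α)} (h : ∀ b ≠ a, τ (of b) = of b)
    {L : List (α × Bool)} (hL : ∀ x ∈ L, x.1 ≠ a) : τ (mk L) = mk L := by
  induction L with
  | nil => exact _root_.map_one _
  | cons x L ih =>
    rw [mk_cons_eq_mul, _root_.map_mul, ih fun y hy => hL y (by simp [hy])]
    congr 1
    have hx := hL x (by simp)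
    rcases mk_singleton_eq x with e | e <;> rw [e] <;> simp [h _ hx]

/-- `U'` is obtained from `U` by sliding the letter `c`, which precedes `d` in `U`, along `d`, so
that it follows `d⁻¹` in `U'`. -/
def IsSlide (c d : α × Bool) (U U' : List (α × Bool)) : Prop :=
  (∃ A B C, U = A ++ c :: d :: (B ++ flipSign d :: C) ∧ U' = A ++ d :: (B ++ flipSign d :: c :: C)) ∨
  (∃ A B C, U = A ++ flipSign d :: (B ++ c :: d :: C) ∧ U' = A ++ flipSign d :: c :: (B ++ d :: C))

theorem IsSlide.perm {c d : α × Bool} {U U' : List (α × Bool)} (h : IsSlide c d U U') :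
    U'.Perm U := by
  rcases h with ⟨A, B, C, rfl, rfl⟩ | ⟨A, B, C, rfl, rfl⟩ <;>
  · classical
    rw [List.perm_iff_count]
    intro a
    simp only [List.count_append, List.count_cons]
    omega

set_option linter.unusedSimpArgs false in
/-- The automorphism `d ↦ c d` carries `U'` to `U`, and compatibly carries the prefixes ending in
front of any letter not involved. -/
theorem IsSlide.apply {c d : α × Bool} {U U' : List (α × Bool)} (h : IsSlide c d U U')
    (hU : U.Nodup) (hcd : c.1 ≠ d.1) {τ : MulAut (FreeGroup α)} (h1 : τ (mk [d]) = mk [c] * mk [d])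
    (h2 : ∀ b ≠ d.1, τ (of b) = of b) :
    τ (mk U') = mk U ∧ ∀ e ∈ U, e ≠ c → e.1 ≠ d.1 →
      ∃ P Q P' Q', U = P ++ e :: Q ∧ U' = P' ++ e :: Q' ∧ τ (mk P') = mk P := by
  have hc : τ (mk [c]) = mk [c] := apply_mk_of_fixes h2 (by simpa using hcd)
  have key : ∀ {L : List (α × Bool)}, d ∉ L → flipSign d ∉ L → ∀ x ∈ L, x.1 ≠ d.1 := by
    intro L a1 a2 x hx e
    rcases eq_or_eq_flipSign e with rfl | rfl
    exacts [a1 hx, a2 hx]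
  rcases h with ⟨A, B, C, rfl, rfl⟩ | ⟨A, B, C, rfl, rfl⟩ <;>
  · simp only [List.nodup_append, List.nodup_cons, List.mem_append, List.mem_cons, not_or] at hU
    have hA' := key (L := A) (fun h => hU.2.2 d h d (by simp) rfl)
      (fun h => hU.2.2 _ h (flipSign d) (by simp) rfl)
    have hB' := key (L := B) (by grind) (by grind)
    have hC' := key (L := C) (by grind) (by grind)
    have hA := apply_mk_of_fixes h2 hA'
    have hB := apply_mk_of_fixes h2 hB'
    have hC := apply_mk_of_fixes h2 hC'
    constructor
    · simp only [← mul_mk, mk_cons_cons, mk_cons_append, mk_cons_eq_mul d C, mk_cons_eq_mul c C, mk_cons_eq_mul (flipSign d) C,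
        _root_.map_mul, _root_.map_inv, h1, hc, hA, hB, hC, mk_flipSign]
      group
    · intro e he hec hed
      have hed1 : e ≠ d := fun h => hed (by rw [h])
      have hed2 : e ≠ flipSign d := fun h => hed (by rw [h]; rfl)
      simp only [List.mem_append, List.mem_cons, hec, hed1, hed2, false_or] at he
      rcases he with he | he | he <;> obtain ⟨L, M, rfl⟩ := List.append_of_mem he
      · exact ⟨L, _, L, _, by rw [List.append_assoc]; rfl, by rw [List.append_assoc]; rfl,
          apply_mk_of_fixes h2 fun x hx => hA' x (by simp [hx])⟩
      all_goals
        have hL : τ (mk L) = mk L := apply_mk_of_fixes h2 fun x hx => by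
          first
          | exact hB' x (by simp [hx])
          | exact hC' x (by simp [hx])
      all_goals first
        | exact ⟨A ++ c :: d :: L, _, A ++ d :: L, _, by simp; rfl, by simp; rfl, by
            simp only [← mul_mk, mk_cons_cons, mk_cons_append, mk_cons_eq_mul d L, mk_cons_eq_mul c L, mk_cons_eq_mul (flipSign d) L,
              _root_.map_mul, _root_.map_inv, h1, hc, hA, hL, mk_flipSign]; group⟩
        | exact ⟨A ++ c :: d :: (B ++ flipSign d :: L), _, A ++ d :: (B ++ flipSign d :: c :: L), _,
            by simp; rfl, by simp; rfl, by
            simp only [← mul_mk, mk_cons_cons, mk_cons_append, mk_cons_eq_mul d L, mk_cons_eq_mul c L, mk_cons_eq_mul (flipSign d) L,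
              _root_.map_mul, _root_.map_inv, h1, hc, hA, hB, hL, mk_flipSign]; group⟩
        | exact ⟨A ++ flipSign d :: L, _, A ++ flipSign d :: c :: L, _, by simp; rfl, by simp; rfl, by
            simp only [← mul_mk, mk_cons_cons, mk_cons_append, mk_cons_eq_mul d L, mk_cons_eq_mul c L, mk_cons_eq_mul (flipSign d) L,
              _root_.map_mul, _root_.map_inv, h1, hc, hA, hL, mk_flipSign]; group⟩
        | exact ⟨A ++ flipSign d :: (B ++ c :: d :: L), _, A ++ flipSign d :: c :: (B ++ d :: L), _,
            by simp; rfl, by simp; rfl, by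
            simp only [← mul_mk, mk_cons_cons, mk_cons_append, mk_cons_eq_mul d L, mk_cons_eq_mul c L, mk_cons_eq_mul (flipSign d) L,
              _root_.map_mul, _root_.map_inv, h1, hc, hA, hB, hL, mk_flipSign]; group⟩

end

variable {α : Type*} [DecidableEq α]

/-- The endomorphism `a ↦ u a v` fixing the other generators. -/
def transvectionHom (a : α) (u v : FreeGroup α) : FreeGroup α →* FreeGroup α :=
  FreeGroup.lift fun l => if l = a then u * of a * v else of l

theorem transvectionHom_mk {a : α} {u v : FreeGroup α} {L : List (α × Bool)}
    (h : ∀ x ∈ L, x.1 ≠ a) : transvectionHom a u v (mk L) = mk L := by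
  induction L with
  | nil => exact _root_.map_one _
  | cons x L ih =>
    rw [mk_cons_eq_mul, _root_.map_mul, ih fun y hy => h y (by simp [hy])]
    congr 1
    have hx := h x (by simp)
    rcases mk_singleton_eq x with e | e <;> rw [e] <;> simp [transvectionHom, hx]

/-- For letters `b ≠ a`, the automorphism `a ↦ u a v`, where `u` and `v` do not involve `a`. -/
def transvection (a : α) (u v : FreeGroup α)
    (hu : ∀ u' v', transvectionHom a u' v' u = u) (hv : ∀ u' v', transvectionHom a u' v' v = v) :
    MulAut (FreeGroup α) :=
  MonoidHom.toMulEquiv (transvectionHom a u v) (transvectionHom a u⁻¹ v⁻¹)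
    (by
      ext l
      by_cases h : l = a
      · subst h
        have : transvectionHom l u v (of l) = u * of l * v := by simp [transvectionHom]
        rw [MonoidHom.comp_apply, this, _root_.map_mul, _root_.map_mul, hu, hv]
        simp [transvectionHom]
        group
      · simp [transvectionHom, h])
    (by
      ext l
      by_cases h : l = a
      · subst h
        have : transvectionHom l u⁻¹ v⁻¹ (of l) = u⁻¹ * of l * v⁻¹ := by simp [transvectionHom]
        rw [MonoidHom.comp_apply, this, _root_.map_mul, _root_.map_mul, _root_.map_inv,
          _root_.map_inv, hu, hv]
        simp [transvectionHom]
        group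
      · simp [transvectionHom, h])

theorem exists_transvection (a : α) {L M : List (α × Bool)} (hL : ∀ x ∈ L, x.1 ≠ a)
    (hM : ∀ x ∈ M, x.1 ≠ a) : ∃ τ : MulAut (FreeGroup α), τ (of a) = mk L * of a * mk M ∧
      ∀ b ≠ a, τ (of b) = of b := by
  refine ⟨transvection a (mk L) (mk M) (fun _ _ => transvectionHom_mk hL)
    (fun _ _ => transvectionHom_mk hM), ?_, fun b hb => ?_⟩
  · change transvectionHom a (mk L) (mk M) (of a) = _
    simp [transvectionHom]
  · change transvectionHom a (mk L) (mk M) (of b) = _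
    simp [transvectionHom, hb]

theorem exists_slide {c d : α × Bool} (h : c.1 ≠ d.1) : ∃ τ : MulAut (FreeGroup α),
    τ (mk [d]) = mk [c] * mk [d] ∧ ∀ b ≠ d.1, τ (of b) = of b := by
  obtain ⟨d, s⟩ := d
  cases s
  · obtain ⟨τ, h1, h2⟩ := exists_transvection d (L := []) (M := [flipSign c]) (by simp)
      (by simpa [flipSign] using h)
    refine ⟨τ, ?_, h2⟩
    have e : mk [(d, false)] = (of d)⁻¹ := by simp [of, invRev]
    rw [e, _root_.map_inv, h1, mk_flipSign, ← one_eq_mk]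
    group
  · obtain ⟨τ, h1, h2⟩ := exists_transvection d (L := [c]) (M := []) (by simpa using h) (by simp)
    refine ⟨τ, ?_, h2⟩
    have e : mk [(d, true)] = of d := rfl
    rw [e, h1, ← one_eq_mk, mul_one]

theorem exists_conj {c : α × Bool} {d : α} (h : c.1 ≠ d) : ∃ τ : MulAut (FreeGroup α),
    τ (of d) = mk [c] * of d * (mk [c])⁻¹ ∧ ∀ b ≠ d, τ (of b) = of b := by
  obtain ⟨τ, h1, h2⟩ := exists_transvection d (L := [c]) (M := [flipSign c]) (by simpa using h)
      (by simpa [flipSign] using h)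
  exact ⟨τ, by rw [h1, mk_flipSign], h2⟩

/-- The total weight of the images of the generators. -/
noncomputable def totalWeight [Fintype α] (ψ : MulAut (FreeGroup α)) : ℕ := ∑ a, weight (ψ (of a))

theorem totalWeight_lt [Fintype α] {ψ ψ' : MulAut (FreeGroup α)} {d : α × Bool}
    (h1 : ∀ b ≠ d.1, ψ' (of b) = ψ (of b)) (h2 : weight (ψ' (mk [d])) < weight (ψ (mk [d]))) :
    totalWeight ψ' < totalWeight ψ := by
  have h3 : weight (ψ' (of d.1)) < weight (ψ (of d.1)) := by
    rcases mk_singleton_eq d with e | e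
    · rwa [e] at h2
    · rwa [e, _root_.map_inv, _root_.map_inv, weight_inv, weight_inv] at h2
  refine Finset.sum_lt_sum (fun a _ => ?_) ⟨d.1, Finset.mem_univ _, h3⟩
  by_cases h : a = d.1
  · rw [h]; exact h3.le
  · rw [h1 a h]

end FreeGroup

/-- The integral Heisenberg group. -/
@[ext] structure Heisenberg where
  /-- first coordinate -/
  a : ℤ
  /-- second coordinate -/
  b : ℤ
  /-- central coordinate -/
  c : ℤ

namespace Heisenberg

instance : Mul Heisenberg := ⟨fun u v => ⟨u.a + v.a, u.b + v.b, u.c + v.c + u.a * v.b⟩⟩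
instance : One Heisenberg := ⟨⟨0, 0, 0⟩⟩
instance : Inv Heisenberg := ⟨fun u => ⟨-u.a, -u.b, -u.c + u.a * u.b⟩⟩

@[simp] theorem mul_a (u v : Heisenberg) : (u * v).a = u.a + v.a := rfl
@[simp] theorem mul_b (u v : Heisenberg) : (u * v).b = u.b + v.b := rfl
@[simp] theorem mul_c (u v : Heisenberg) : (u * v).c = u.c + v.c + u.a * v.b := rfl
@[simp] theorem one_a : (1 : Heisenberg).a = 0 := rfl
@[simp] theorem one_b : (1 : Heisenberg).b = 0 := rfl
@[simp] theorem one_c : (1 : Heisenberg).c = 0 := rfl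
@[simp] theorem inv_a (u : Heisenberg) : u⁻¹.a = -u.a := rfl
@[simp] theorem inv_b (u : Heisenberg) : u⁻¹.b = -u.b := rfl
@[simp] theorem inv_c (u : Heisenberg) : u⁻¹.c = -u.c + u.a * u.b := rfl

instance : Group Heisenberg :=
  Group.ofLeftAxioms (fun u v w => by ext <;> simp <;> ring) (fun u => by ext <;> simp)
    (fun u => by ext <;> simp)

/-- The first coordinate as a homomorphism. -/
def aHom : Heisenberg →* Multiplicative ℤ where
  toFun u := .ofAdd u.a
  map_one' := rfl
  map_mul' _ _ := rfl

/-- The second coordinate as a homomorphism. -/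
def bHom : Heisenberg →* Multiplicative ℤ where
  toFun u := .ofAdd u.b
  map_one' := rfl
  map_mul' _ _ := rfl

theorem comm_eq (u v : Heisenberg) : SurfaceAut.comm u v = ⟨0, 0, u.a * v.b - v.a * u.b⟩ := by
  ext <;> simp [SurfaceAut.comm]
  ring

theorem c_prod_comm {ι : Type*} (L : List ι) (u v : ι → Heisenberg) :
    (L.map fun i => SurfaceAut.comm (u i) (v i)).prod.c =
      (L.map fun i => (u i).a * (v i).b - (v i).a * (u i).b).sum := by
  induction L with
  | nil => rfl
  | cons i L ih =>
    rw [List.map_cons, List.prod_cons, mul_c, ih, comm_eq]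
    simp

end Heisenberg

namespace SurfaceAut
open FreeGroup
variable {g p : ℕ}

/-- The exponent sum of a letter. -/
noncomputable def expSum (v : Letter g p) : F g p →* Multiplicative ℤ :=
  FreeGroup.lift fun l => if l = v then .ofAdd 1 else 1

/-- A homomorphism to the Heisenberg group with prescribed first two coordinates. -/
def heisenbergHom (f k : F g p →* Multiplicative ℤ) : F g p →* Heisenberg :=
  FreeGroup.lift fun l => ⟨(f (of l)).toAdd, (k (of l)).toAdd, 0⟩

theorem heisenbergHom_a (f k : F g p →* Multiplicative ℤ) (z : F g p) :
    (heisenbergHom f k z).a = (f z).toAdd := by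
  have : Heisenberg.aHom.comp (heisenbergHom f k) = f := by
    ext l; simp [heisenbergHom, Heisenberg.aHom]
  exact DFunLike.congr_fun this z

theorem heisenbergHom_b (f k : F g p →* Multiplicative ℤ) (z : F g p) :
    (heisenbergHom f k z).b = (k z).toAdd := by
  have : Heisenberg.bHom.comp (heisenbergHom f k) = k := by
    ext l; simp [heisenbergHom, Heisenberg.bHom]
  exact DFunLike.congr_fun this z

theorem heisenbergHom_expSum_c {v : Letter g p} (k : F g p →* Multiplicative ℤ)
    {L : List (Letter g p × Bool)} (hL : ∀ l ∈ L, l.1 ≠ v) :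
    (heisenbergHom (expSum v) k (mk L)).c = 0 ∧ (heisenbergHom (expSum v) k (mk L)).a = 0 := by
  induction L with
  | nil =>
    rw [← one_eq_mk, _root_.map_one]
    exact ⟨rfl, rfl⟩
  | cons l L ih =>
    obtain ⟨h1, h2⟩ := ih fun l hl => hL l (by simp [hl])
    have hl := hL l (by simp)
    rw [mk_cons_eq_mul, _root_.map_mul, Heisenberg.mul_c, Heisenberg.mul_a, h1, h2]
    rcases mk_singleton_eq l with e | e <;> rw [e] <;> simp [heisenbergHom, expSum, hl]

/-- The algebraic intersection form of the surface is nondegenerate: no generator can be omitted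
from a word for the boundary. -/
theorem IsMarking.fst_ne_fst {V : List (Letter g p × Bool)} {ψ : MulAut (F g p)}
    (h : IsMarking V ψ) {A B : List (Letter g p × Bool)} {a b : Letter g p × Bool}
    (hV : V = A ++ a :: b :: B) : a.1 ≠ b.1 := by
  intro hab
  have hn := h.nodup
  rw [hV] at hn
  simp only [List.nodup_append, List.nodup_cons, List.mem_cons, not_or] at hn
  have hb : b = flipSign a := by
    rcases eq_or_eq_flipSign hab with e | e
    · exact absurd e hn.2.1.1.1
    · rw [e, flipSign_flipSign]
  subst hb
  have hvt : ∀ j, a.1 ≠ .t j := by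
    intro j hj
    have h1 : a.2 = true := (h.mem_t (j := j)).1 (by rw [← hj, hV]; simp)
    have h2 : (!a.2) = true := (h.mem_t (j := j)).1 (by rw [← hj, hV]; simp [flipSign])
    simp [h1] at h2
  have hL : ∀ L : List (Letter g p × Bool), (∀ l ∈ L, l ∈ A ∨ l ∈ B) → ∀ l ∈ L, l.1 ≠ a.1 := by
    intro L hL l hl e
    have := hL l hl
    rcases eq_or_eq_flipSign e with rfl | rfl <;> grind
  have hmk : mk V = mk (A ++ B) := by
    rw [hV, ← mul_mk, ← mul_mk, mk_cons_eq_mul, mk_cons_eq_mul (flipSign a), mk_flipSign]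
    group
  have hT : ∀ k : F g p →* Multiplicative ℤ, (∀ j, k (t g j) = 1) → ∀ j,
      heisenbergHom (expSum a.1) (k.comp ψ.toMonoidHom) (ψ⁻¹ (t g j)) = 1 := by
    intro k hk j
    obtain ⟨i, hi⟩ := exists_isConj_of_mem_permutesT (inv_mem h.mem) j
    refine map_eq_one_of_isConj _ hi ?_
    obtain ⟨i', hi'⟩ := exists_isConj_of_mem_permutesT h.mem i
    have e1 : k (ψ (t g i)) = 1 := map_eq_one_of_isConj _ hi' (hk i')
    have e2 : expSum a.1 (t g i) = 1 := by simp [expSum, t, (hvt i).symm]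
    unfold t at e1 e2 ⊢
    simp [heisenbergHom, e1, e2]
    rfl
  have key : ∀ k : F g p →* Multiplicative ℤ, (∀ j, k (t g j) = 1) →
      ((List.finRange g).map fun i => (expSum a.1 (ψ⁻¹ (x p i))).toAdd * (k (y p i)).toAdd -
        (expSum a.1 (ψ⁻¹ (y p i))).toAdd * (k (x p i)).toAdd).sum = 0 := by
    intro k hk
    set θ := heisenbergHom (expSum a.1) (k.comp ψ.toMonoidHom) with hθ
    have h1 : (θ (ψ⁻¹ (boundaryWord g p))).c = 0 := by
      rw [← h.map_mk, MulAut.inv_apply_self, hmk]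
      exact (heisenbergHom_expSum_c _ (hL _ (by simp))).1
    have h2 : θ (ψ⁻¹ (boundaryWord g p)) =
        ((List.finRange g).map fun i => comm (θ (ψ⁻¹ (x p i))) (θ (ψ⁻¹ (y p i)))).prod := by
      rw [boundaryWord_eq, _root_.map_mul, _root_.map_mul, map_list_prod, map_list_prod,
        List.prod_eq_one, one_mul, commProd, map_list_prod, map_list_prod, List.map_map,
        List.map_map]
      · refine congrArg List.prod (List.map_congr_left fun i _ => ?_)
        simp [comm]
      · simp only [List.map_map, List.mem_map]
        rintro _ ⟨j, -, rfl⟩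
        exact hT k hk j
    rw [h2, Heisenberg.c_prod_comm] at h1
    rw [← h1]
    refine congrArg List.sum (List.map_congr_left fun i _ => ?_)
    rw [hθ, heisenbergHom_a, heisenbergHom_b, heisenbergHom_a, heisenbergHom_b]
    simp
  have hsum : ∀ (f : Fin g → ℤ) (i : Fin g),
      ((List.finRange g).map fun j => if j = i then f j else 0).sum = f i := by
    intro f i
    have : (List.finRange g).map (fun j => if j = i then f j else 0) =
        List.ofFn fun j => if j = i then f j else 0 := by rw [List.ofFn_eq_map]
    rw [this, List.sum_ofFn]
    simp
  have hx : ∀ i, (expSum a.1 (ψ⁻¹ (x p i))).toAdd = 0 := by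
    intro i
    have := key (expSum (.y i)) (fun j => by simp [expSum, t])
    rw [← hsum (fun i => (expSum a.1 (ψ⁻¹ (x p i))).toAdd) i]
    refine (congrArg List.sum (List.map_congr_left fun j _ => ?_)).trans this
    have e1 : expSum (.y i) (y p j) = if j = i then .ofAdd 1 else 1 := by simp [expSum, y]
    have e2 : expSum (.y i) (x p j) = 1 := by simp [expSum, x]
    rw [e1, e2]
    split_ifs <;> simp
  have hy : ∀ i, (expSum a.1 (ψ⁻¹ (y p i))).toAdd = 0 := by
    intro i
    have := key (expSum (.x i)) (fun j => by simp [expSum, t])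
    rw [← neg_eq_zero, ← hsum (fun i => -(expSum a.1 (ψ⁻¹ (y p i))).toAdd) i]
    refine (congrArg List.sum (List.map_congr_left fun j _ => ?_)).trans this
    have e1 : expSum (.x i) (x p j) = if j = i then .ofAdd 1 else 1 := by simp [expSum, x]
    have e2 : expSum (.x i) (y p j) = 1 := by simp [expSum, y]
    rw [e1, e2]
    split_ifs <;> simp
  have h1 : (expSum a.1).comp (ψ⁻¹).toMonoidHom = 1 := by
    refine hom_ext_letters (fun j => ?_) (fun i => ?_) (fun i => ?_)
    · have := congrArg Heisenberg.a (hT 1 (by simp) j)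
      rw [heisenbergHom_a] at this
      exact this
    · exact hx i
    · exact hy i
  have h2 : expSum a.1 (ψ⁻¹ (ψ (of a.1))) = 1 := DFunLike.congr_fun h1 (ψ (of a.1))
  rw [MulAut.inv_apply_self] at h2
  simp [expSum] at h2

/-- The letter is one of the `t_j`. -/
def IsT (l : Letter g p) : Prop := ∃ j, l = .t j

/-- Two marked words with a common value of a front. -/
def ShareFront (V : List (Letter g p × Bool)) (ψ : MulAut (F g p))
    (V' : List (Letter g p × Bool)) (ψ' : MulAut (F g p)) : Prop :=
  ∃ P j Q P' Q', V = P ++ (.t j, true) :: Q ∧ V' = P' ++ (.t j, true) :: Q' ∧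
    ψ (front P j) = ψ' (front P' j)

theorem mem_permutesT_of_fixes {d : Letter g p} (hd : ¬ IsT d) {τ : MulAut (F g p)}
    (h2 : ∀ b ≠ d, τ (of b) = of b) : τ ∈ permutesT g p :=
  mem_permutesT (Equiv.refl _) fun j => by
    rw [t, t, h2 _ fun h => hd ⟨j, h.symm⟩]
    exact IsConj.refl _

theorem isSlide_link (hp : 2 ≤ p) {c d : Letter g p × Bool} {U U' : List (Letter g p × Bool)}
    (h : IsSlide c d U U') (hperm : U.Perm (boundaryList g p)) (hcd : c.1 ≠ d.1) (hd : ¬ IsT d.1)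
    {τ : MulAut (F g p)} (h1 : τ (mk [d]) = mk [c] * mk [d])
    (h2 : ∀ b ≠ d.1, τ (of b) = of b) :
    τ (mk U') = mk U ∧ ∃ P j Q P' Q', U = P ++ (.t j, true) :: Q ∧ U' = P' ++ (.t j, true) :: Q' ∧
      τ (front P' j) = front P j := by
  obtain ⟨h3, h4⟩ := h.apply (hperm.nodup_iff.2 nodup_boundaryList) hcd h1 h2
  refine ⟨h3, ?_⟩
  have : ∃ j : Fin p, c.1 ≠ .t j := by
    by_cases h : c.1 = .t ⟨0, by omega⟩
    · exact ⟨⟨1, by omega⟩, by rw [h]; simp⟩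
    · exact ⟨_, h⟩
  obtain ⟨j, hj⟩ := this
  have htd : Letter.t j ≠ d.1 := fun e => hd ⟨j, e.symm⟩
  obtain ⟨P, Q, P', Q', hP, hP', e⟩ := h4 (.t j, true)
    (hperm.mem_iff.2 (mem_boundaryList_t.2 rfl)) (fun e => hj (by rw [← e])) htd
  refine ⟨P, j, Q, P', Q', hP, hP', ?_⟩
  rw [front, _root_.map_mul, _root_.map_mul, _root_.map_inv, e, t, h2 _ htd]
  rfl

theorem mul_apply_mk_eq {ψ τ : MulAut (F g p)} {d : Letter g p}
    (h2 : ∀ b ≠ d, τ (of b) = of b) : ∀ b ≠ d, (ψ * τ) (of b) = ψ (of b) := fun b hb => by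
  rw [MulAut.mul_apply, h2 b hb]

theorem IsMarking.fst_ne_t {V : List (Letter g p × Bool)} {ψ : MulAut (F g p)}
    (h : IsMarking V ψ) {L : List (Letter g p × Bool)} {j : Fin p} (hL : L ⊆ V)
    (hj : (.t j, true) ∉ L) : ∀ l ∈ L, l.1 ≠ .t j := by
  rintro ⟨l, b⟩ hl rfl
  have := h.mem_t.1 (hL hl)
  subst this
  exact hj hl

/-- If in a marked word the image of a letter can be made smaller by sliding or conjugation along
a neighbour, then there is a smaller marked word which shares a front with the given one. -/
theorem IsMarking.exists_lt (hp : 2 ≤ p) {V : List (Letter g p × Bool)} {ψ : MulAut (F g p)}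
    (h : IsMarking V ψ) {A B : List (Letter g p × Bool)} {c d : Letter g p × Bool}
    (hV : V = A ++ c :: d :: B)
    (hlt : (¬ IsT d.1 ∧ weight (ψ (mk [c]) * ψ (mk [d])) < weight (ψ (mk [d]))) ∨
      (IsT d.1 ∧ weight (ψ (mk [c]) * ψ (mk [d]) * (ψ (mk [c]))⁻¹) < weight (ψ (mk [d]))) ∨
      (¬ IsT c.1 ∧ weight (ψ (mk [c]) * ψ (mk [d])) < weight (ψ (mk [c]))) ∨
      (IsT c.1 ∧ weight ((ψ (mk [d]))⁻¹ * ψ (mk [c]) * ψ (mk [d])) < weight (ψ (mk [c])))) :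
    ∃ V' ψ', IsMarking V' ψ' ∧ totalWeight ψ' < totalWeight ψ ∧ ShareFront V ψ V' ψ' := by
  have hcd := h.fst_ne_fst hV
  have hmem : ∀ {e : Letter g p × Bool}, ¬ IsT e.1 → e ∈ V := by
    rintro ⟨j | i | i, b⟩ he
    · exact absurd ⟨j, rfl⟩ he
    · exact h.perm.mem_iff.2 mem_boundaryList_x
    · exact h.perm.mem_iff.2 mem_boundaryList_y
  have hn := h.nodup
  rw [hV] at hn
  simp only [List.nodup_append, List.nodup_cons, List.mem_cons, not_or] at hn
  have hTt : ∀ {e : Letter g p × Bool}, IsT e.1 → e ∈ V → ∃ j, e = (.t j, true) := by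
    rintro ⟨e, b⟩ ⟨j, rfl⟩ he
    exact ⟨j, by rw [h.mem_t.1 he]⟩
  rcases hlt with ⟨hd, hw⟩ | ⟨hd, hw⟩ | ⟨hc, hw⟩ | ⟨hc, hw⟩
  · obtain ⟨τ, h1, h2⟩ := exists_slide hcd
    have hf : flipSign d ∈ A ∨ flipSign d ∈ B := by
      have := hmem (e := flipSign d) hd
      rw [hV] at this
      simp only [List.mem_append, List.mem_cons, flipSign_ne, false_or] at this
      rcases this with h' | h' | h'
      exacts [.inl h', absurd (congrArg Prod.fst h').symm hcd, .inr h']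
    have hs : ∃ V', IsSlide c d V V' := by
      rcases hf with hf | hf <;> obtain ⟨L, M, rfl⟩ := List.append_of_mem hf
      · exact ⟨_, .inr ⟨L, M, B, by rw [hV]; simp, rfl⟩⟩
      · exact ⟨_, .inl ⟨A, L, M, hV, rfl⟩⟩
    obtain ⟨V', hs⟩ := hs
    obtain ⟨h3, P, j, Q, P', Q', hP, hP', e⟩ := isSlide_link hp hs h.perm hcd hd h1 h2
    refine ⟨V', ψ * τ, ⟨hs.perm.trans h.perm, mul_mem h.mem (mem_permutesT_of_fixes hd h2), ?_⟩,
      totalWeight_lt (d := d) (mul_apply_mk_eq h2) ?_, P, j, Q, P', Q', hP, hP', ?_⟩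
    · rw [MulAut.mul_apply, h3, h.map_mk]
    · rw [MulAut.mul_apply, h1, _root_.map_mul]; exact hw
    · rw [MulAut.mul_apply, e]
  · obtain ⟨j, rfl⟩ := hTt hd (by rw [hV]; simp)
    obtain ⟨τ, h1, h2⟩ := exists_conj hcd
    change τ (mk [(.t j, true)]) = _ * mk [(.t j, true)] * _ at h1
    simp only at h2
    have hA := apply_mk_of_fixes h2 (L := A) (h.fst_ne_t (by rw [hV]; intro x hx; simp [hx])
      fun hx => hn.2.2 _ hx _ (by simp) rfl)
    have hB := apply_mk_of_fixes h2 (L := B) (h.fst_ne_t (by rw [hV]; intro x hx; simp [hx])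
      fun hx => hn.2.1.2.1 hx)
    have hc := apply_mk_of_fixes h2 (L := [c]) (by simpa using hcd)
    refine ⟨A ++ (.t j, true) :: c :: B, ψ * τ, ⟨?_, mul_mem h.mem ?_, ?_⟩,
      totalWeight_lt (d := (.t j, true)) (mul_apply_mk_eq h2) ?_, A ++ [c], j, B, A, c :: B,
      by rw [hV]; simp, rfl, ?_⟩
    · refine List.Perm.trans ?_ h.perm
      rw [hV]
      exact (List.Perm.swap _ _ _).append_left _
    · refine mem_permutesT (Equiv.refl _) fun i => ?_
      by_cases hij : i = j
      · subst hij
        exact isConj_iff.2 ⟨mk [c], h1.symm⟩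
      · rw [t, t, h2 _ (by simpa using hij)]
        exact IsConj.refl _
    · rw [← h.map_mk, MulAut.mul_apply, hV]
      congr 1
      rw [← mul_mk, ← mul_mk, mk_cons_cons, mk_cons_cons, mk_cons_eq_mul c B,
        mk_cons_eq_mul (Letter.t j, true) B]
      simp only [_root_.map_mul, hA, hB, h1, hc]
      group
    · rw [MulAut.mul_apply, h1, _root_.map_mul, _root_.map_mul, _root_.map_inv]; exact hw
    · rw [MulAut.mul_apply]
      congr 1
      simp only [front, _root_.map_mul, _root_.map_inv, hA, ← mul_mk]
      change _ = _ * τ (mk [(.t j, true)]) * _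
      rw [h1, t]
      change _ = mk A * (mk [c] * of (.t j) * _) * _
      group
  · obtain ⟨τ, h1, h2⟩ := exists_slide (c := d) (d := flipSign c) hcd.symm
    have hf : flipSign c ∈ A ∨ flipSign c ∈ B := by
      have := hmem (e := flipSign c) hc
      rw [hV] at this
      simp only [List.mem_append, List.mem_cons, flipSign_ne, false_or] at this
      rcases this with h' | h' | h'
      exacts [.inl h', absurd (congrArg Prod.fst h') hcd, .inr h']
    have hs : ∃ V', IsSlide d (flipSign c) V' V := by
      rcases hf with hf | hf <;> obtain ⟨L, M, rfl⟩ := List.append_of_mem hf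
      · exact ⟨_, .inl ⟨L, M, B, rfl, by rw [hV]; simp⟩⟩
      · exact ⟨_, .inr ⟨A, L, M, rfl, by rw [hV]; simp⟩⟩
    obtain ⟨V', hs⟩ := hs
    have hperm := hs.perm.symm.trans h.perm
    obtain ⟨h3, P', j, Q', P, Q, hP', hP, e⟩ := isSlide_link hp hs hperm hcd.symm hc h1 h2
    have h2' : ∀ b ≠ (flipSign c).1, τ⁻¹ (of b) = of b := fun b hb => by
      rw [← h2 b hb, MulAut.inv_apply_self, h2 b hb]
    have hfix : τ⁻¹ (mk [d]) = mk [d] := apply_mk_of_fixes h2' (by simpa [flipSign] using hcd.symm)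
    have h1' : τ⁻¹ (mk [flipSign c]) = (mk [d])⁻¹ * mk [flipSign c] := by
      have := congrArg (fun z => τ⁻¹ z) h1
      rw [MulAut.inv_apply_self, _root_.map_mul, hfix] at this
      exact eq_inv_mul_of_mul_eq this.symm
    refine ⟨V', ψ * τ⁻¹, ⟨hperm, mul_mem h.mem (inv_mem (mem_permutesT_of_fixes hc h2)), ?_⟩,
      totalWeight_lt (d := flipSign c) (mul_apply_mk_eq h2') ?_, P, j, Q, P', Q', hP, hP', ?_⟩
    · rw [MulAut.mul_apply, ← h3, MulAut.inv_apply_self, h.map_mk]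
    · rw [MulAut.mul_apply, h1', mk_flipSign, ← mul_inv_rev, _root_.map_inv, _root_.map_inv, weight_inv,
        weight_inv, _root_.map_mul]
      exact hw
    · rw [MulAut.mul_apply, ← e, MulAut.inv_apply_self]
  · obtain ⟨j, rfl⟩ := hTt hc (by rw [hV]; simp)
    obtain ⟨τ, h1, h2⟩ := exists_conj (c := flipSign d) (d := .t j) hcd.symm
    rw [mk_flipSign, inv_inv] at h1
    change τ (mk [(.t j, true)]) = _ * mk [(.t j, true)] * _ at h1
    have hA := apply_mk_of_fixes h2 (L := A) (h.fst_ne_t (by rw [hV]; intro x hx; simp [hx])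
      fun hx => hn.2.2 _ hx _ (by simp) rfl)
    have hB := apply_mk_of_fixes h2 (L := B) (h.fst_ne_t (by rw [hV]; intro x hx; simp [hx])
      fun hx => hn.2.1.1.2 hx)
    have hd := apply_mk_of_fixes h2 (L := [d]) (by simpa using hcd.symm)
    refine ⟨A ++ d :: (.t j, true) :: B, ψ * τ, ⟨?_, mul_mem h.mem ?_, ?_⟩,
      totalWeight_lt (d := (.t j, true)) (mul_apply_mk_eq h2) ?_, A, j, d :: B, A ++ [d], B,
      hV, by simp, ?_⟩
    · refine List.Perm.trans ?_ h.perm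
      rw [hV]
      exact (List.Perm.swap _ _ _).append_left _
    · refine mem_permutesT (Equiv.refl _) fun i => ?_
      by_cases hij : i = j
      · subst hij
        exact isConj_iff.2 ⟨(mk [d])⁻¹, by rw [inv_inv]; exact h1.symm⟩
      · rw [t, t, h2 _ (by simpa using hij)]
        exact IsConj.refl _
    · rw [← h.map_mk, MulAut.mul_apply, hV]
      congr 1
      rw [← mul_mk, ← mul_mk, mk_cons_cons, mk_cons_cons, mk_cons_eq_mul d B,
        mk_cons_eq_mul (Letter.t j, true) B]
      simp only [_root_.map_mul, hA, hB, h1, hd]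
      group
    · rw [MulAut.mul_apply, h1, _root_.map_mul, _root_.map_mul, _root_.map_inv]; exact hw
    · rw [MulAut.mul_apply]
      congr 1
      simp only [front, _root_.map_mul, _root_.map_inv, hA, hd, ← mul_mk]
      change _ = _ * τ (mk [(.t j, true)]) * _
      rw [h1, t]
      change _ = mk A * mk [d] * (_ * of (.t j) * _) * _
      group

end SurfaceAut

namespace SurfaceAut
open FreeGroup
variable {g p : ℕ}

theorem front_boundaryList_mem_tOrbit (hp : 2 ≤ p) {P Q : List (Letter g p × Bool)} {j : Fin p}
    (h : boundaryList g p = P ++ (.t j, true) :: Q) : front P j ∈ tOrbit g p hp := by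
  have hC : ∀ L : List (Letter g p × Bool), L <:+ ((List.finRange g).flatMap fun i =>
      [((.x i, false) : Letter g p × Bool), (.y i, false), (.x i, true), (.y i, true)]) →
      (.t j, true) ∉ L := by
    intro L hL hmem
    have := hL.subset hmem
    simp at this
  rw [boundaryList, List.append_eq_append_iff] at h
  have : ∃ c, (List.finRange p).reverse.map (fun j => ((.t j, true) : Letter g p × Bool)) =
      P ++ (.t j, true) :: c := by
    rcases h with ⟨a, -, h2⟩ | ⟨c, h1, h2⟩
    · exact absurd (by simp) (hC _ ⟨a, h2.symm⟩)
    · rcases c with _ | ⟨c0, c⟩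
      · exact absurd (by simp) (hC _ ⟨[], h2⟩)
      · simp only [List.cons_append, List.cons.injEq] at h2
        exact ⟨c, by rw [h1, ← h2.1]⟩
  obtain ⟨c, hc⟩ := this
  rw [List.map_eq_append_iff] at hc
  obtain ⟨A, R, hAR, rfl, hR⟩ := hc
  rw [List.map_eq_cons_iff] at hR
  obtain ⟨i, B, rfl, hi, -⟩ := hR
  simp only [Prod.mk.injEq, Letter.t.injEq, and_true] at hi
  subst hi
  rw [front, mk_map_t]
  exact conj_prod_t_mem_tOrbit hp hAR

theorem exists_toWord_apply_t {ψ : MulAut (F g p)} (h : ψ ∈ permutesT g p) (j : Fin p) :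
    ∃ U k, toWord (ψ (t g j)) = U ++ [(.t k, true)] ++ invRev U := by
  obtain ⟨k, hk⟩ := exists_isConj_of_mem_permutesT h j
  obtain ⟨c, hc⟩ := isConj_iff.1 hk
  obtain ⟨U, hU⟩ := exists_toWord_conj_of c (.t k : Letter g p)
  exact ⟨U, k, by rw [← hU, ← hc]; rfl⟩

/-- If no sliding or conjugation along a neighbour makes the image of a letter smaller, then `ψ`
carries `V` to the boundary word letter by letter. -/
theorem IsMarking.map_letter {V : List (Letter g p × Bool)} {ψ : MulAut (F g p)}
    (h : IsMarking V ψ) (hp : 0 < p)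
    (hmin : ∀ A c d B, V = A ++ c :: d :: B →
      (¬ IsT d.1 → weight (ψ (mk [d])) ≤ weight (ψ (mk [c]) * ψ (mk [d]))) ∧
      (IsT d.1 → weight (ψ (mk [d])) ≤ weight (ψ (mk [c]) * ψ (mk [d]) * (ψ (mk [c]))⁻¹)) ∧
      (¬ IsT c.1 → weight (ψ (mk [c])) ≤ weight (ψ (mk [c]) * ψ (mk [d]))) ∧
      (IsT c.1 → weight (ψ (mk [c])) ≤ weight ((ψ (mk [d]))⁻¹ * ψ (mk [c]) * ψ (mk [d])))) :
    ∀ i : ℕ, (V[i]?).map (fun l => ψ (mk [l])) = ((boundaryList g p)[i]?).map fun l => mk [l] := by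
  have hTt : ∀ {e : Letter g p × Bool}, IsT e.1 → e ∈ V → ∃ j, e = (.t j, true) := by
    rintro ⟨e, b⟩ ⟨j, rfl⟩ he
    exact ⟨j, by rw [h.mem_t.1 he]⟩
  have hconj : ∀ e ∈ V, IsT e.1 → IsLetterConj true (ψ (mk [e])) := by
    intro e he hT
    obtain ⟨j, rfl⟩ := hTt hT he
    obtain ⟨U, k, hU⟩ := exists_toWord_apply_t h.mem j
    exact ⟨U, _, hU⟩
  have hlen : V.length = (boundaryList g p).length := h.perm.length_eq
  set n := V.length with hn
  have hn0 : 0 < n := by rw [hlen, length_boundaryList]; omega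
  let z : ℕ → F g p := fun i => (V[i]?).elim 1 fun l => ψ (mk [l])
  have hz : ∀ {i l}, V[i]? = some l → z i = ψ (mk [l]) := fun {i l} hi => by simp only [z, hi]; rfl
  have hget : ∀ {i}, i < n → ∃ l, V[i]? = some l := fun {i} hi =>
    ⟨_, List.getElem?_eq_getElem hi⟩
  have hlt : ∀ {i l}, V[i]? = some l → i < n := fun {i l} hi => by
    rw [List.getElem?_eq_some_iff] at hi
    exact hi.1
  have hprod : ((List.range n).map z).prod = boundaryWord g p := by
    have e1 : (List.range n).map z = V.map fun l => ψ (mk [l]) := by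
      apply List.ext_getElem
      · simp [hn]
      · intro i h1 h2
        simp only [List.getElem_map, List.getElem_range]
        exact hz (List.getElem?_eq_getElem _)
    have e2 : ∀ L, (L.map fun l => ψ (mk [l])).prod = ψ (mk L) := by
      intro L
      induction L with
      | nil => simp [← one_eq_mk]
      | cons l L ih => rw [List.map_cons, List.prod_cons, ih, mk_cons_eq_mul l L, _root_.map_mul]
    rw [e1, e2, h.map_mk]
  obtain ⟨k, a, hk0, ha, hs⟩ := exists_surviving_letters z hn0
    (by
      intro i hi h1
      obtain ⟨l, hl⟩ := hget hi
      rw [hz hl, EmbeddingLike.map_eq_one_iff] at h1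
      rcases mk_singleton_eq l with e | e <;> rw [e] at h1 <;> simp [FreeGroup.of_ne_one] at h1)
    (by
      intro i hi
      have hV : V = V.take i ++ V[i] :: V[i + 1] :: V.drop (i + 2) := by
        conv_lhs => rw [← List.take_append_drop i V, List.drop_eq_getElem_cons (by omega),
          List.drop_eq_getElem_cons (by omega)]
      obtain ⟨h1, h2, h3, h4⟩ := hmin _ _ _ _ hV
      rw [hz (List.getElem?_eq_getElem (by omega)), hz (List.getElem?_eq_getElem hi)]
      exact cancelled_bounds (hconj _ (List.getElem_mem _)) (hconj _ (List.getElem_mem _))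
        h1 h2 h3 h4)
    (by rw [hprod, ← mk_boundaryList, hlen]; exact norm_mk_le)
  have hW : boundaryList g p = (List.range n).map a := by
    rw [← ha, hprod, ← mk_boundaryList, toWord_mk_of_length_le]
    rw [mk_boundaryList, ← hprod, FreeGroup.norm, ha, ← hlen]
    simp
  have hWi : ∀ {i}, i < n → (boundaryList g p)[i]? = some (a i) := fun {i} hi => by
    rw [hW]; simp [hi]
  have hWlt : ∀ {i l}, (boundaryList g p)[i]? = some l → i < n := fun {i l} hi => by
    rw [List.getElem?_eq_some_iff] at hi
    rw [hlen]; exact hi.1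
  have hpair : ∀ {i j l}, V[i]? = some l → V[j]? = some (flipSign l) →
      k i = k (j + 1) ∧ a j = flipSign (a i) := by
    intro i j l hi hj
    obtain ⟨s1, s2, s3, s4, s5, s6⟩ := hs i (hlt hi)
    obtain ⟨r1, r2, r3, r4, r5, r6⟩ := hs j (hlt hj)
    have hzj : z j = (z i)⁻¹ := by rw [hz hi, hz hj, mk_flipSign, _root_.map_inv]
    rw [hzj] at r1 r2 r3 r4 r5 r6
    rw [inv_inv] at r5 r6
    rw [norm_inv_eq] at r1 r3 r4 r5 r6
    have e1 : k i = k (j + 1) := by omega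
    refine ⟨e1, ?_⟩
    rw [toWord_inv, invRev, List.getElem?_reverse (by rw [List.length_map]; unfold FreeGroup.norm at *; omega),
      List.getElem?_map, List.length_map,
      show (toWord (z i)).length - 1 - k j = k i by unfold FreeGroup.norm at *; omega, s2] at r2
    exact (Option.some.inj r2).symm
  have hTi : ∀ {i j}, V[i]? = some (.t j, true) → k i = k (i + 1) ∧ ∃ m, a i = (.t m, true) := by
    intro i j hi
    obtain ⟨s1, s2, s3, s4, -, -⟩ := hs i (hlt hi)
    obtain ⟨U, m, hU⟩ := exists_toWord_apply_t h.mem j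
    have hzi : z i = ψ (t g j) := hz hi
    rw [← hzi] at hU
    have hN : FreeGroup.norm (z i) = 2 * U.length + 1 := by rw [FreeGroup.norm, hU]; simp; omega
    have hk : k i = U.length := by omega
    refine ⟨by omega, m, ?_⟩
    rw [hU, hk] at s2
    simpa using s2.symm
  have hmem : ∀ {e : Letter g p × Bool}, ¬ IsT e.1 → ∃ j : ℕ, V[j]? = some e := by
    intro e he
    rw [← List.mem_iff_getElem?]
    obtain ⟨j | i | i, b⟩ := e
    · exact absurd ⟨j, rfl⟩ he
    · exact h.perm.mem_iff.2 mem_boundaryList_x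
    · exact h.perm.mem_iff.2 mem_boundaryList_y
  have hk : ∀ i ≤ n, k i = 0 := by
    rw [hlen]
    refine eq_zero_of_glued hk0 ?_ ?_
    · intro i j hi
      obtain ⟨l, hl⟩ := hget (hWlt hi)
      by_cases hT : IsT l.1
      · obtain ⟨j', rfl⟩ := hTt hT (List.mem_of_getElem? hl)
        exact (hTi hl).1
      · obtain ⟨j', hj'⟩ := hmem (e := flipSign l) hT
        have h1 := (hpair hl hj').2
        rw [hWi (hWlt hi), Option.some.injEq] at hi
        have h2 := List.mem_of_getElem? (hWi (hlt hj'))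
        rw [h1, hi] at h2
        simp [flipSign, mem_boundaryList_t] at h2
    · intro i j l b hi hj
      obtain ⟨m, hm⟩ := hget (hWlt hi)
      have hai := hi
      rw [hWi (hWlt hi), Option.some.injEq] at hai
      by_cases hT : IsT m.1
      · obtain ⟨j', rfl⟩ := hTt hT (List.mem_of_getElem? hm)
        obtain ⟨-, q, hq⟩ := hTi hm
        rw [hai, Prod.mk.injEq] at hq
        obtain ⟨rfl, rfl⟩ := hq
        have h2 := List.mem_of_getElem? hj
        simp [mem_boundaryList_t] at h2
      · obtain ⟨j', hj'⟩ := hmem (e := flipSign m) hT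
        obtain ⟨h1, h2⟩ := hpair hm hj'
        have h3 := hWi (hlt hj')
        rw [h2, hai] at h3
        have : j' = j := by
          have hjl := hWlt hj
          have hjl' := hlt hj'
          rw [hlen] at hjl hjl'
          rw [List.getElem?_eq_getElem hjl, Option.some.injEq] at hj
          rw [List.getElem?_eq_getElem hjl', Option.some.injEq] at h3
          exact (List.Nodup.getElem_inj_iff nodup_boundaryList).1 (h3.trans hj.symm)
        rw [← this, h1]
  intro i
  by_cases hi : i < n
  · obtain ⟨l, hl⟩ := hget hi
    obtain ⟨s1, s2, -⟩ := hs i hi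
    rw [hk i (by omega), hk (i + 1) (by omega)] at s1
    rw [hk i (by omega)] at s2
    obtain ⟨b, hb⟩ := List.length_eq_one_iff.1 s1
    rw [hb] at s2
    simp only [List.getElem?_cons_zero, Option.some.injEq] at s2
    rw [hl, hWi hi, Option.map_some, Option.map_some, ← hz hl, ← mk_toWord (x := z i), hb, s2]
  · rw [List.getElem?_eq_none (by omega), List.getElem?_eq_none (by omega)]
    rfl

theorem IsMarking.front_mem_of_minimal (hp : 2 ≤ p) {V : List (Letter g p × Bool)}
    {ψ : MulAut (F g p)} (h : IsMarking V ψ)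
    (hV : ∀ i : ℕ, (V[i]?).map (fun l => ψ (mk [l])) = ((boundaryList g p)[i]?).map fun l => mk [l])
    {P Q : List (Letter g p × Bool)} {j : Fin p} (hP : V = P ++ (.t j, true) :: Q) :
    ψ (front P j) ∈ tOrbit g p hp := by
  have htake : ∀ m, ψ (mk (V.take m)) = mk ((boundaryList g p).take m) := by
    intro m
    induction m with
    | zero => simp [← one_eq_mk]
    | succ m ih =>
      rw [List.take_add_one, List.take_add_one, ← mul_mk, ← mul_mk, _root_.map_mul, ih]
      congr 1
      have := hV m
      cases h1 : V[m]? <;> cases h2 : (boundaryList g p)[m]? <;> rw [h1, h2] at this <;>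
        simp [← one_eq_mk] at this ⊢
      exact this
  have h1 : V[P.length]? = some (.t j, true) := by rw [hP]; simp
  have h2 := hV P.length
  rw [h1, Option.map_some] at h2
  have h3 : V.take P.length = P := by rw [hP]; simp
  obtain ⟨l, hl, hl'⟩ := Option.map_eq_some_iff.1 h2.symm
  have hW : boundaryList g p = (boundaryList g p).take P.length ++ l ::
      (boundaryList g p).drop (P.length + 1) := by
    obtain ⟨hlt, rfl⟩ := List.getElem?_eq_some_iff.1 hl
    conv_lhs => rw [← List.take_append_drop P.length (boundaryList g p),
      List.drop_eq_getElem_cons hlt]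
  have hlT : ∃ m, l = (.t m, true) := by
    obtain ⟨U, m, hU⟩ := exists_toWord_apply_t h.mem j
    change mk [l] = ψ (t g j) at hl'
    rw [← hl', toWord_mk, reduce_singleton] at hU
    have := congrArg List.length hU
    simp at this
    have : U = [] := by rw [← List.length_eq_zero_iff]; omega
    subst this
    exact ⟨m, by simpa using hU⟩
  obtain ⟨m, rfl⟩ := hlT
  have := front_boundaryList_mem_tOrbit hp hW
  rw [front, _root_.map_mul, _root_.map_mul, _root_.map_inv, ← h3, htake]
  change _ * ψ (mk [(.t j, true)]) * _ ∈ _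
  rw [← hl']
  exact this

/-- All fronts of all marked words lie in the orbit of `t_p`. -/
theorem IsMarking.apply_front_mem_tOrbit (hp : 2 ≤ p) {V : List (Letter g p × Bool)}
    {ψ : MulAut (F g p)} (h : IsMarking V ψ) {P Q : List (Letter g p × Bool)} {j : Fin p}
    (hP : V = P ++ (.t j, true) :: Q) : ψ (front P j) ∈ tOrbit g p hp := by
  induction hw : totalWeight ψ using Nat.strong_induction_on generalizing V ψ P Q j with
  | _ w ih =>
    by_cases hred : ∃ V' ψ', IsMarking V' ψ' ∧ totalWeight ψ' < totalWeight ψ ∧ ShareFront V ψ V' ψ'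
    · obtain ⟨V', ψ', h', hlt, R, i, S, R', S', hR, hR', e⟩ := hred
      exact h.front_mem_tOrbit hR (e ▸ ih _ (hw ▸ hlt) h' hR' rfl) hP
    · refine h.front_mem_of_minimal hp (h.map_letter (by omega) fun A c d B hV => ?_) hP
      have hnot := mt (h.exists_lt hp hV) hred
      simp only [not_or, not_and, not_lt] at hnot
      exact hnot

theorem isMarking_boundaryList {φ : MulAut (F g p)} (h : φ ∈ A g p) :
    IsMarking (boundaryList g p) φ :=
  ⟨List.Perm.refl _, (mem_A.1 h).2, by rw [mk_boundaryList]; exact (mem_A.1 h).1⟩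

theorem A_le_stabTwist (hp : 2 ≤ p) : A g p ≤ stabTwist g p hp := by
  intro φ hφ
  have hmem : (.t ⟨p - 1, pred_lt_of_two_le hp⟩, true) ∈ boundaryList g p := mem_boundaryList_t.2 rfl
  obtain ⟨P, Q, hPQ⟩ := List.append_of_mem hmem
  exact mem_stabTwist_of_apply_mem_tOrbit hφ (front_boundaryList_mem_tOrbit hp hPQ)
    ((isMarking_boundaryList hφ).apply_front_mem_tOrbit hp hPQ)

end SurfaceAut

theorem theorem3p4 (g p : ℕ) (hp : 2 ≤ p) :
    Subgroup.closure
        ((SurfaceAut.stabA (SurfaceAut.t g (⟨p - 1, by omega⟩ : Fin p)) :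
            Set (MulAut (SurfaceAut.F g p))) ∪
          {SurfaceAut.sigma g p p hp le_rfl}) =
      SurfaceAut.A g p :=
  le_antisymm (SurfaceAut.stabTwist_le_A hp) (SurfaceAut.A_le_stabTwist hp)
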